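/- Let $M$ be a Kähler surface with complex structure $J$, metric $\langle\cdot,\cdot\rangle$ and Kähler form $\omega(U,V)=\langle JU,V\rangle$. Let $F:\Sigma\to M$ be a smooth immersion of an oriented real surface which is symplectic, i.e. its Kähler angle $\alpha$, defined by $F^*\omega=\cos\alpha\,d\mu_\Sigma$, satisfies $\cos\alpha>0$ (for instance, a $\beta$-symplectic critical surface). Let $\beta\ge 0$ and let $\mathbf H$ be the mean curvature vector of $\Sigma$; $(\cdot)^\top$ and $(\cdot)^\perp$ denote tangential and normal components. Consider the Euler–Lagrange operator $$Q(F)=\cos^3\alpha\,\mathbf H-\beta\bigl(J(J\nabla\cos\alpha)^\top\bigr)^\perp$$ of the $\beta$-symplectic critical surface equation $Q(F)=0$, and the normalized operator $P=Q/\cos\alpha$, i.e. $P=\cos^2\alpha\,\mathbf H-\beta\bigl(J(\nabla_{e_1}\cos\alpha\, e_2-\nabla_{e_2}\cos\alpha\, e_1)\bigr)^\perp$ for an oriented orthonormal tangent frame. In local coordinates (positively oriented on $\Sigma$, holomorphic on $M$), the linearizations at $F$ of $Q$ and of $P$ are second order linear differential operators $v\mapsto A^{ij}\partial_i\partial_jv+B^i\partial_iv+Cv$;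 their principal symbols are $\sigma(x,\xi)=A^{ij}(x)\xi_i\xi_j$. Then: 1. The equation is an elliptic system modulo tangential diffeomorphisms of $\Sigma$: for both $Q$ and $P$, for every $x\in\Sigma$ and every $0\neq\xi\in T_x^*\Sigma$, the kernel of $\sigma(x,\xi):T_{F(x)}M\to T_{F(x)}M$ is the tangent plane $dF(T_x\Sigma)$, and $\sigma(x,\xi)$ maps the normal space of $\Sigma$ at $x$ bijectively onto itself. 2. For the operator $P$, every $x\in\Sigma$, every orthonormal basis $e_1=dF(a_1),e_2=dF(a_2)$ of $dF(T_x\Sigma)$ and every $G\in T_{F(x)}M$, with $\xi_i=\xi(a_i)$ one has $\langle\sigma(x,\xi)G,G\rangle=\sum_{i,j}O_{ij}\xi_i\xi_j$ for all $\xi\in T_x^*\Sigma$, where $O$ is the symmetric matrix $$O=\begin{pmatrix}\cos^2\alpha|G^\perp|^2+\beta\langle G^\perp,Je_2\rangle^2&-\beta\langle G^\perp,Je_1\rangle\langle G^\perp,Je_2\rangle\\-\beta\langle G^\perp,Je_1\rangle\langle G^\perp,Je_2\rangle&\cos^2\alpha|G^\perp|^2+\beta\langle G^\perp,Je_1\rangle^2\end{pmatrix},$$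 with $$\det O=\cos^2\alpha|G^\perp|^2\bigl[\cos^2\alpha|G^\perp|^2+\beta(\langle G^\perp,Je_1\rangle^2+\langle G^\perp,Je_2\rangle^2)\bigr],$$ and $O$ is positive definite if and only if $G^\perp\neq0$. -/

import Mathlib

open scoped Manifold ContDiff

noncomputable section

namespace BetaSymplectic

/-! ### Kähler surfaces, oriented surfaces -/

/-- The model space `ℂ²` of a complex surface, also used as a real vector space. -/
abbrev CC2 := EuclideanSpace ℂ (Fin 2)

/-- The model space `ℝ²` of a real surface. -/
abbrev RR2 := EuclideanSpace ℝ (Fin 2)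

/-- The complex structure of `ℂ²`, multiplication by `i`, as a real linear map. On a complex
surface it is also the complex structure `J` of each tangent space, because Mathlib identifies
`T_p M` with `ℂ²` through the differential of a holomorphic chart; for the same reason it is the
expression of `J` in every holomorphic chart. -/
def cxJ : CC2 →L[ℝ] CC2 :=
  (Complex.I • ContinuousLinearMap.id ℂ CC2).restrictScalars ℝ

/-- A complex surface is a smooth real manifold (of real dimension four). -/
instance realManifold (M : Type*) [TopologicalSpace M] [ChartedSpace CC2 M]
    [IsManifold 𝓘(ℂ, CC2) ∞ M] : IsManifold 𝓘(ℝ, CC2) ∞ M := by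
  apply isManifold_of_contDiffOn
  intro e e' he he'
  have h := contMDiffOn_of_mem_contDiffGroupoid
    ((contDiffGroupoid ∞ 𝓘(ℂ, CC2)).compatible he he')
  have h2 := (contMDiffOn_iff_contDiffOn.1 h).restrict_scalars ℝ
  simpa using h2

/-- The expression in the chart `ψ` of a field `B` of bilinear forms on the tangent spaces. -/
def chartBilin {M : Type*} [TopologicalSpace M] [ChartedSpace CC2 M]
    (B : ∀ p : M, TangentSpace 𝓘(ℝ, CC2) p →L[ℝ] TangentSpace 𝓘(ℝ, CC2) p →L[ℝ] ℝ)
    (ψ : OpenPartialHomeomorph M CC2) (u : CC2) : CC2 →L[ℝ] CC2 →L[ℝ] ℝ :=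
  let b : CC2 →L[ℝ] CC2 →L[ℝ] ℝ := B (ψ.symm u)
  let d : CC2 →L[ℝ] CC2 := mfderiv 𝓘(ℝ, CC2) 𝓘(ℝ, CC2) ψ.symm u
  b.bilinearComp d d

/-- A Kähler metric on a complex surface: a smooth Riemannian metric which is invariant under `J`
and whose fundamental form `ω(X, Y) = ⟨J X, Y⟩` is closed (`dω = 0`, in holomorphic charts). -/
structure KahlerMetric (M : Type*) [TopologicalSpace M] [ChartedSpace CC2 M]
    [IsManifold 𝓘(ℂ, CC2) ∞ M] extends
    Bundle.ContMDiffRiemannianMetric 𝓘(ℝ, CC2) ∞ CC2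
      (fun p : M => TangentSpace 𝓘(ℝ, CC2) p) where
  inner_J : ∀ (p : M) (v w : TangentSpace 𝓘(ℝ, CC2) p), inner p (cxJ v) (cxJ w) = inner p v w
  closed : ∀ ψ ∈ IsManifold.maximalAtlas 𝓘(ℂ, CC2) ∞ M, ∀ u ∈ ψ.target, ∀ X Y Z : CC2,
    fderiv ℝ (fun v => chartBilin inner ψ v (cxJ Y) Z) u X
      + fderiv ℝ (fun v => chartBilin inner ψ v (cxJ Z) X) u Y
      + fderiv ℝ (fun v => chartBilin inner ψ v (cxJ X) Y) u Z = 0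

/-- The expression of a Kähler metric in a chart. -/
def KahlerMetric.chart {M : Type*} [TopologicalSpace M] [ChartedSpace CC2 M]
    [IsManifold 𝓘(ℂ, CC2) ∞ M] (g : KahlerMetric M) (ψ : OpenPartialHomeomorph M CC2) :
    CC2 → CC2 →L[ℝ] CC2 →L[ℝ] ℝ :=
  chartBilin g.inner ψ

/-- An orientation of the real surface `S`, given by an oriented atlas. -/
structure OrientedAtlas (S : Type*) [TopologicalSpace S] [ChartedSpace RR2 S] where
  charts : Set (OpenPartialHomeomorph S RR2)
  subset_maximalAtlas : charts ⊆ IsManifold.maximalAtlas 𝓘(ℝ, RR2) ∞ S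
  cover : ∀ p : S, ∃ φ ∈ charts, p ∈ φ.source
  det_pos : ∀ φ ∈ charts, ∀ φ' ∈ charts, ∀ z ∈ (φ.symm.trans φ').source,
    0 < (fderiv ℝ (φ' ∘ φ.symm) z).det

/-! ### Geometry of a surface in local coordinates

Here `h` is the ambient metric in a holomorphic chart and `f` is the surface in local coordinates;
`Fin 2 = {0, 1}` stands for the indices `{1, 2}`. -/

/-- The partial derivative `∂ᵢ f`. -/
def pd {E : Type*} [NormedAddCommGroup E] [NormedSpace ℝ E] (i : Fin 2) (f : RR2 → E) (y : RR2) :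
    E :=
  fderiv ℝ f y (EuclideanSpace.single i 1)

/-- The Christoffel symbol `Γ_u(X, Y)` of the Levi-Civita connection of `h`, that is, the vector
with `h(Γ(X, Y), W) = ½ (D_X h (Y, W) + D_Y h (X, W) - D_W h (X, Y))` for all `W`. -/
def christoffel (h : CC2 → CC2 →L[ℝ] CC2 →L[ℝ] ℝ) (u X Y : CC2) : CC2 :=
  (h u).inverse ((1 / 2 : ℝ) •
    (fderiv ℝ h u X Y + fderiv ℝ h u Y X - ((fderiv ℝ h u).flip X).flip Y))

section Local

variable (h : CC2 → CC2 →L[ℝ] CC2 →L[ℝ] ℝ) (f : RR2 → CC2) (y : RR2)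

/-- The induced metric `g_{ij}`. -/
def gram : Matrix (Fin 2) (Fin 2) ℝ :=
  Matrix.of fun i j => h (f y) (pd i f y) (pd j f y)

/-- The cosine of the Kähler angle: `ω(∂₁f, ∂₂f) = cos α √(det g)`. -/
def cosAngle : ℝ :=
  h (f y) (cxJ (pd 0 f y)) (pd 1 f y) / Real.sqrt (gram h f y).det

/-- The tangential component `Z^⊤`. -/
def tangPart (Z : CC2) : CC2 :=
  ∑ i, ∑ j, ((gram h f y)⁻¹ i j * h (f y) Z (pd i f y)) • pd j f y

/-- The normal component `Z^⊥`. -/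
def normPart (Z : CC2) : CC2 := Z - tangPart h f y Z

/-- The mean curvature vector, the trace of the second fundamental form `(∇̄_X Y)^⊥`. -/
def meanCurv : CC2 :=
  normPart h f y (∑ i, ∑ j, (gram h f y)⁻¹ i j •
    (pd i (pd j f) y + christoffel h (f y) (pd i f y) (pd j f y)))

/-- The gradient of `cos α` on the surface, as a tangent vector of the ambient space. -/
def gradCos : CC2 :=
  ∑ i, ∑ j, ((gram h f y)⁻¹ i j * pd i (cosAngle h f) y) • pd j f y

/-- The left-hand side `cos³α H - β (J (J ∇cos α)^⊤)^⊥` of the Euler-Lagrange equation. -/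
def elOp (β : ℝ) : CC2 :=
  (cosAngle h f y) ^ 3 • meanCurv h f y
    - β • normPart h f y (cxJ (tangPart h f y (cxJ (gradCos h f y))))

/-- The Euler-Lagrange operator divided by `cos α`; since
`(J ∇cos α)^⊤ = cos α (∇_{e₁} cos α e₂ - ∇_{e₂} cos α e₁)` for an oriented orthonormal frame,
it is `cos²α H - β (J (∇_{e₁} cos α e₂ - ∇_{e₂} cos α e₁))^⊥`. -/
def normalizedOp (β : ℝ) : CC2 := (cosAngle h f y)⁻¹ • elOp h f y β

/-- The tangent plane of the surface. -/
def tangentPlane : Submodule ℝ CC2 := LinearMap.range (fderiv ℝ f y).toLinearMap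

/-- The normal vectors of the surface. -/
def normalSet : Set CC2 := {Z | ∀ X ∈ tangentPlane f y, h (f y) Z X = 0}

end Local

/-! ### Linearization and principal symbol -/

/-- The linearization at `f` of the nonlinear operator `P` exists at the point `y` and is the
second order linear differential operator `v ↦ ∑ Aᵢⱼ ∂ᵢ∂ⱼ v + ∑ Bᵢ ∂ᵢ v + C v`, with principal
symbol `σ(ξ) = ∑ ξᵢ ξⱼ Aᵢⱼ`. -/
def HasPrincipalSymbolAt (P : (RR2 → CC2) → RR2 → CC2) (f : RR2 → CC2) (y : RR2)
    (σ : (RR2 →L[ℝ] ℝ) → CC2 →L[ℝ] CC2) : Prop :=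
  ∃ (A : Fin 2 → Fin 2 → CC2 →L[ℝ] CC2) (B : Fin 2 → CC2 →L[ℝ] CC2) (C : CC2 →L[ℝ] CC2),
    (∀ v : RR2 → CC2, ContDiff ℝ ∞ v →
      HasDerivAt (fun t : ℝ => P (fun z => f z + t • v z) y)
        ((∑ i, ∑ j, A i j (pd i (pd j v) y)) + (∑ i, B i (pd i v y)) + C (v y)) 0) ∧
    ∀ ξ : RR2 →L[ℝ] ℝ, σ ξ =
      ∑ i, ∑ j, (ξ (EuclideanSpace.single i 1) * ξ (EuclideanSpace.single j 1)) • A i j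

/-- The symbol `σ` at `y` is elliptic modulo tangential diffeomorphisms: for every `ξ ≠ 0`, the
kernel of `σ(ξ)` consists of the directions tangent to the surface (the infinitesimal
reparametrizations), and `σ(ξ)` is an isomorphism of the normal space. -/
def IsEllipticModTangent (h : CC2 → CC2 →L[ℝ] CC2 →L[ℝ] ℝ) (f : RR2 → CC2) (y : RR2)
    (σ : (RR2 →L[ℝ] ℝ) → CC2 →L[ℝ] CC2) : Prop :=
  ∀ ξ : RR2 →L[ℝ] ℝ, ξ ≠ 0 →
    (∀ G, σ ξ G = 0 ↔ G ∈ tangentPlane f y) ∧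
    Set.BijOn (σ ξ) (normalSet h f y) (normalSet h f y)

section Global

variable {M : Type*} [TopologicalSpace M] [ChartedSpace CC2 M] [IsManifold 𝓘(ℂ, CC2) ∞ M]
  {S : Type*} [TopologicalSpace S] [ChartedSpace RR2 S]

/-- `F` expressed in the charts `φ` of `S` and `ψ` of `M`. -/
def localRep (F : S → M) (φ : OpenPartialHomeomorph S RR2) (ψ : OpenPartialHomeomorph M CC2) :
    RR2 → CC2 :=
  ψ ∘ F ∘ φ.symm

/-- A property of the metric and the surface at a point holds in all positively oriented local
coordinates `φ` of the given atlas of `S` and all holomorphic local coordinates `ψ` of `M`. -/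
def InCharts (g : KahlerMetric M) (A : OrientedAtlas S) (F : S → M)
    (Q : (CC2 → CC2 →L[ℝ] CC2 →L[ℝ] ℝ) → (RR2 → CC2) → RR2 → Prop) : Prop :=
  ∀ φ ∈ A.charts, ∀ ψ ∈ IsManifold.maximalAtlas 𝓘(ℂ, CC2) ∞ M,
    ∀ p ∈ φ.source, F p ∈ ψ.source → Q (g.chart ψ) (localRep F φ ψ) (φ p)

/-- `F` is a smooth immersion. -/
def IsSmoothImmersion (F : S → M) : Prop :=
  ContMDiff 𝓘(ℝ, RR2) 𝓘(ℝ, CC2) ∞ F ∧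
    ∀ p, Function.Injective (mfderiv 𝓘(ℝ, RR2) 𝓘(ℝ, CC2) F p)

/-- The surface is symplectic: `cos α > 0` everywhere. -/
def IsSymplectic (g : KahlerMetric M) (A : OrientedAtlas S) (F : S → M) : Prop :=
  InCharts g A F fun h f y => 0 < cosAngle h f y

end Global

end BetaSymplectic

end

noncomputable section

namespace BetaSymplectic

/-! ### Linear algebra of a plane in a Hermitian vector space -/

/-! Vary the first derivatives of the surface by `ξ i • G` and the second derivatives by `ξ i * ξ j
• G`. For an orthonormal tangent frame `e` put `W = ξ₀ J e₁ - ξ₁ J e₀`, where `ξₖ` are the frame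
coordinates of the covector. The trace in `H` changes by `|ξ|² G`. Up to the orientation sign of the
frame, `cos α` changes by `-⟨G^⊥, W⟩` (`IsFrame.angle_symbol`): a tangential variation does not move
the plane to first order. Since `(J ·)^⊤` acts on the tangent plane as `cos α` times a rotation, the
second term of `Q` returns a multiple of `W^⊥`, and the symbol of `Q` is `cos α (cos²α |ξ|² G^⊥ + β
⟨G^⊥, W⟩ W^⊥)` (`IsFrame.elSymbol_eq`).

Pairing the bracket, which is the symbol of `P`, with `G` gives `cos²α |ξ|² |G^⊥|² + β ⟨G^⊥, W⟩²`.
For `β ≥ 0` and `cos α ≠ 0` this is positive unless `G^⊥ = 0` or `ξ = 0`. Hence the kernel is the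
tangent plane, and the normal space, being finite-dimensional and preserved, is mapped bijectively
(`IsFrame.isEllipticModTangent`). Expanding the same expression in `ξ` gives the matrix `O`.

To see that this algebra computes the actual linearization, the operator is written as a
differentiable function of the 2-jet (`elOp_eq_jetOp`, `differentiableAt_jetOp`); its differential
contains the linearization (`hasPrincipalSymbolAt_of_jet`). This function is affine in the second
derivatives, which gives the symbol as a slope (`fderiv_jetOp_symbolJet`). -/

lemma cxJ_cxJ (X : CC2) : cxJ (cxJ X) = -X := by
  simp [cxJ, smul_smul]

/-- The Gram matrix of the vectors `p` for the bilinear form `b`. -/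
def bilinGram (b : CC2 →L[ℝ] CC2 →L[ℝ] ℝ) (p : Fin 2 → CC2) : Matrix (Fin 2) (Fin 2) ℝ :=
  Matrix.of fun i j => b (p i) (p j)

/-- The orthogonal projection onto the span of `p`. -/
def bilinTang (b : CC2 →L[ℝ] CC2 →L[ℝ] ℝ) (p : Fin 2 → CC2) (Z : CC2) : CC2 :=
  ∑ i, ∑ j, ((bilinGram b p)⁻¹ i j * b Z (p i)) • p j

/-- The cosine of the Kähler angle of the plane spanned by `p`. -/
def bilinCos (b : CC2 →L[ℝ] CC2 →L[ℝ] ℝ) (p : Fin 2 → CC2) : ℝ :=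
  b (cxJ (p 0)) (p 1) / Real.sqrt (bilinGram b p).det

/-- A positive definite symmetric bilinear form invariant under the complex structure. -/
structure IsHermitianForm (b : CC2 →L[ℝ] CC2 →L[ℝ] ℝ) : Prop where
  symm : ∀ X Y, b X Y = b Y X
  pos : ∀ X, X ≠ 0 → 0 < b X X
  cxJ : ∀ X Y, b (cxJ X) (cxJ Y) = b X Y

lemma IsHermitianForm.cxJ_left {b : CC2 →L[ℝ] CC2 →L[ℝ] ℝ} (hb : IsHermitianForm b) (X Y : CC2) :
    b (BetaSymplectic.cxJ X) Y = -b X (BetaSymplectic.cxJ Y) := by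
  rw [← hb.cxJ (BetaSymplectic.cxJ X) Y, cxJ_cxJ]
  simp

lemma IsHermitianForm.cxJ_antisymm {b : CC2 →L[ℝ] CC2 →L[ℝ] ℝ} (hb : IsHermitianForm b)
    (X Y : CC2) : b (BetaSymplectic.cxJ X) Y = -b (BetaSymplectic.cxJ Y) X := by
  rw [hb.cxJ_left, hb.symm]

/-- `e` is the orthonormal frame `e k = ∑ i, α k i • p i`. -/
structure IsFrame (b : CC2 →L[ℝ] CC2 →L[ℝ] ℝ) (p e : Fin 2 → CC2)
    (α : Matrix (Fin 2) (Fin 2) ℝ) : Prop where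
  eq : ∀ k, e k = ∑ i, α k i • p i
  orthonormal : ∀ i j, b (e i) (e j) = if i = j then 1 else 0

namespace IsFrame

variable {b : CC2 →L[ℝ] CC2 →L[ℝ] ℝ} {p e : Fin 2 → CC2} {α : Matrix (Fin 2) (Fin 2) ℝ}

lemma mul_gram_mul (h : IsFrame b p e α) : α * bilinGram b p * α.transpose = 1 := by
  ext k l
  have := h.orthonormal k l
  rw [h.eq k, h.eq l] at this
  rw [Matrix.one_apply, ← this]
  simp only [bilinGram, Matrix.mul_apply, Fin.sum_univ_two, Matrix.of_apply,
    Matrix.transpose_apply, map_add, map_smul, add_apply, smul_apply, smul_eq_mul]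
  ring

lemma gram_inv (h : IsFrame b p e α) : (bilinGram b p)⁻¹ = α.transpose * α := by
  apply Matrix.inv_eq_left_inv
  rw [Matrix.mul_assoc, mul_eq_one_comm]
  exact h.mul_gram_mul

lemma gram_inv_apply (h : IsFrame b p e α) (i j : Fin 2) :
    (bilinGram b p)⁻¹ i j = ∑ k, α k i * α k j := by
  rw [h.gram_inv, Matrix.mul_apply]
  rfl

lemma det_sq_mul (h : IsFrame b p e α) : α.det ^ 2 * (bilinGram b p).det = 1 := by
  have := congrArg Matrix.det h.mul_gram_mul
  rw [Matrix.det_mul, Matrix.det_mul, Matrix.det_transpose, Matrix.det_one] at this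
  linarith

lemma det_ne_zero (h : IsFrame b p e α) : α.det ≠ 0 := by
  intro h0
  have := h.det_sq_mul
  simp [h0] at this

/-- Frames of either orientation are allowed, so the area element is `|det α|⁻¹`; the sign of `det
α` then enters the Kähler angle. -/
lemma sqrt_det (h : IsFrame b p e α) : Real.sqrt (bilinGram b p).det = |α.det|⁻¹ := by
  have h1 : (bilinGram b p).det = (|α.det|⁻¹) ^ 2 := by
    have := h.det_ne_zero
    rw [inv_pow, sq_abs, ← mul_eq_one_iff_eq_inv₀ (pow_ne_zero 2 this), mul_comm, h.det_sq_mul]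
  rw [h1, Real.sqrt_sq (by positivity)]

lemma tang (h : IsFrame b p e α) (Z : CC2) :
    bilinTang b p Z = b Z (e 0) • e 0 + b Z (e 1) • e 1 := by
  simp only [bilinTang, h.gram_inv_apply, h.eq, Fin.sum_univ_two, map_add, map_smul, smul_eq_mul]
  module

lemma sum_gram_inv_mul (h : IsFrame b p e α) (ξ : Fin 2 → ℝ) :
    ∑ i, ∑ j, (bilinGram b p)⁻¹ i j * (ξ i * ξ j) =
      (∑ i, α 0 i * ξ i) ^ 2 + (∑ i, α 1 i * ξ i) ^ 2 := by
  simp only [h.gram_inv_apply, Fin.sum_univ_two]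
  ring

lemma sum_gram_inv_smul (h : IsFrame b p e α) (ξ : Fin 2 → ℝ) :
    ∑ i, ∑ j, ((bilinGram b p)⁻¹ i j * ξ i) • p j =
      (∑ i, α 0 i * ξ i) • e 0 + (∑ i, α 1 i * ξ i) • e 1 := by
  simp only [h.gram_inv_apply, h.eq, Fin.sum_univ_two]
  module

lemma bilinCos_eq (h : IsFrame b p e α) (hb : IsHermitianForm b) :
    bilinCos b p = SignType.sign α.det * b (cxJ (e 0)) (e 1) := by
  -- The form `b (cxJ ·) ·` is alternating, so a change of basis multiplies it by the determinant.
  have h1 : b (cxJ (e 0)) (e 1) = α.det * b (cxJ (p 0)) (p 1) := by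
    have h00 : b (cxJ (p 0)) (p 0) = 0 := by linarith [hb.cxJ_antisymm (p 0) (p 0)]
    have h11 : b (cxJ (p 1)) (p 1) = 0 := by linarith [hb.cxJ_antisymm (p 1) (p 1)]
    have h10 := hb.cxJ_antisymm (p 1) (p 0)
    simp only [h.eq, Fin.sum_univ_two, map_add, map_smul, add_apply, smul_apply, smul_eq_mul,
      Matrix.det_fin_two, h00, h11, h10]
    ring
  rw [bilinCos, h.sqrt_det, h1, ← mul_assoc, sign_mul_self]
  field_simp

/-- The differential of the Kähler angle in the direction `ξ ⊗ G`, in an orthonormal frame. -/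
lemma angle_symbol (h : IsFrame b p e α) (hb : IsHermitianForm b) (ξ : Fin 2 → ℝ) (G : CC2) :
    (ξ 0 * b (cxJ G) (p 1) + ξ 1 * b (cxJ (p 0)) G) / Real.sqrt (bilinGram b p).det -
        bilinCos b p * ∑ i, ∑ j, (bilinGram b p)⁻¹ i j * (ξ i * b G (p j)) =
      -(SignType.sign α.det * b (G - bilinTang b p G)
        ((∑ i, α 0 i * ξ i) • cxJ (e 1) - (∑ i, α 1 i * ξ i) • cxJ (e 0))) := by
  have hs : |α.det| = SignType.sign α.det * α.det := (sign_mul_self _).symm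
  have h0 : ∀ k, b G (e k) = ∑ i, α k i * b G (p i) := fun k => by
    simp [h.eq]
  have h1 : ∀ k, b G (cxJ (e k)) = ∑ i, α k i * b G (cxJ (p i)) := fun k => by
    simp [h.eq]
  have e01 := hb.cxJ_left (e 0) (e 1)
  have e10 : b (e 1) (cxJ (e 0)) = b (cxJ (e 0)) (e 1) := hb.symm _ _
  have e00 : b (e 0) (cxJ (e 0)) = 0 := by
    linarith [hb.cxJ_left (e 0) (e 0), hb.symm (e 0) (cxJ (e 0))]
  have e11 : b (e 1) (cxJ (e 1)) = 0 := by
    linarith [hb.cxJ_left (e 1) (e 1), hb.symm (e 1) (cxJ (e 1))]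
  have e01' : b (e 0) (cxJ (e 1)) = -b (cxJ (e 0)) (e 1) := by linarith
  -- After these substitutions both sides are polynomials in the entries of `α`, the `ξ i` and the
  -- pairings of `G` with `p i` and `cxJ (p i)`.
  rw [h.sqrt_det, div_inv_eq_mul, hs, h.bilinCos_eq hb, h.tang, hb.cxJ_left G, hb.symm _ G]
  simp only [map_sub, map_add, map_smul, sub_apply, add_apply, smul_apply, smul_eq_mul, e10, e00,
    e11, e01', h.gram_inv_apply]
  rw [h1 0, h1 1, h0 0, h0 1, Matrix.det_fin_two]
  simp only [Fin.sum_univ_two]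
  ring

lemma normal_apply_frame (h : IsFrame b p e α) (Z : CC2) (k : Fin 2) :
    b (Z - bilinTang b p Z) (e k) = 0 := by
  have h0 := h.orthonormal 0 k
  have h1 := h.orthonormal 1 k
  rw [h.tang]
  simp only [map_sub, map_add, map_smul, sub_apply, add_apply, smul_apply, smul_eq_mul, h0, h1]
  fin_cases k <;> simp

lemma tang_add (h : IsFrame b p e α) (Y Z : CC2) :
    bilinTang b p (Y + Z) = bilinTang b p Y + bilinTang b p Z := by
  simp only [h.tang, map_add, add_apply]
  module

lemma tang_smul (h : IsFrame b p e α) (r : ℝ) (Z : CC2) :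
    bilinTang b p (r • Z) = r • bilinTang b p Z := by
  simp only [h.tang, map_smul, smul_apply, smul_eq_mul]
  module

/-- The symmetry of the symbol: `⟨W^⊥, G⟩ = ⟨G^⊥, W⟩`. -/
lemma normal_apply_comm (h : IsFrame b p e α) (hb : IsHermitianForm b) (W G : CC2) :
    b (W - bilinTang b p W) G = b (G - bilinTang b p G) W := by
  simp only [h.tang, map_sub, map_add, map_smul, sub_apply, add_apply, smul_apply, smul_eq_mul,
    hb.symm _ W, hb.symm (e _) G]
  ring

lemma normal_idem (h : IsFrame b p e α) (G : CC2) :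
    bilinTang b p (G - bilinTang b p G) = 0 := by
  rw [h.tang, h.normal_apply_frame, h.normal_apply_frame]
  simp

lemma normal_apply_self (h : IsFrame b p e α) (hb : IsHermitianForm b) (G : CC2) :
    b (G - bilinTang b p G) G = b (G - bilinTang b p G) (G - bilinTang b p G) := by
  have := h.normal_apply_comm hb (G - bilinTang b p G) G
  rwa [h.normal_idem, sub_zero] at this

end IsFrame

/-- The principal symbol of the Euler-Lagrange operator, before passing to a frame. -/
def elSymbol (b : CC2 →L[ℝ] CC2 →L[ℝ] ℝ) (p : Fin 2 → CC2) (β : ℝ) (ξ : Fin 2 → ℝ) (G : CC2) :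
    CC2 :=
  let d := (ξ 0 * b (cxJ G) (p 1) + ξ 1 * b (cxJ (p 0)) G) / Real.sqrt (bilinGram b p).det -
    bilinCos b p * ∑ i, ∑ j, (bilinGram b p)⁻¹ i j * (ξ i * b G (p j))
  let H := ∑ i, ∑ j, (bilinGram b p)⁻¹ i j • (ξ i * ξ j) • G
  let K := cxJ (bilinTang b p (cxJ (∑ i, ∑ j, ((bilinGram b p)⁻¹ i j * (ξ i * d)) • p j)))
  bilinCos b p ^ 3 • (H - bilinTang b p H) - β • (K - bilinTang b p K)

namespace IsFrame

variable {b : CC2 →L[ℝ] CC2 →L[ℝ] ℝ} {p e : Fin 2 → CC2} {α : Matrix (Fin 2) (Fin 2) ℝ}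

/-- Only one projection of `G` survives in each term: the variation of the angle sees just `G^⊥`,
and the outer `J (J ·)^⊤` turns the varied gradient into a multiple of `W`. -/
lemma elSymbol_eq (h : IsFrame b p e α) (hb : IsHermitianForm b) (β : ℝ) (ξ : Fin 2 → ℝ)
    (G : CC2) {W : CC2}
    (hW : W = (∑ i, α 0 i * ξ i) • cxJ (e 1) - (∑ i, α 1 i * ξ i) • cxJ (e 0)) :
    elSymbol b p β ξ G = bilinCos b p •
      ((bilinCos b p ^ 2 * ((∑ i, α 0 i * ξ i) ^ 2 + (∑ i, α 1 i * ξ i) ^ 2)) •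
          (G - bilinTang b p G) +
        (β * b (G - bilinTang b p G) W) • (W - bilinTang b p W)) := by
  have hs : (SignType.sign α.det : ℝ) * SignType.sign α.det = 1 := by
    rcases lt_or_gt_of_ne h.det_ne_zero with hd | hd <;> simp [hd]
  have hc := h.bilinCos_eq hb
  have hd := h.angle_symbol hb ξ G
  have e01 := hb.cxJ_antisymm (e 1) (e 0)
  have e00 : b (cxJ (e 0)) (e 0) = 0 := by linarith [hb.cxJ_antisymm (e 0) (e 0)]
  have e11 : b (cxJ (e 1)) (e 1) = 0 := by linarith [hb.cxJ_antisymm (e 1) (e 1)]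
  rw [← hW] at hd
  rw [elSymbol]
  simp only [hd]
  set l := b (G - bilinTang b p G) W
  set s : ℝ := ((SignType.sign α.det : SignType) : ℝ)
  set η₀ := ∑ i, α 0 i * ξ i
  set η₁ := ∑ i, α 1 i * ξ i
  have hH : ∑ i, ∑ j, (bilinGram b p)⁻¹ i j • (ξ i * ξ j) • G = (η₀ ^ 2 + η₁ ^ 2) • G := by
    rw [← h.sum_gram_inv_mul ξ]
    simp only [Finset.sum_smul, mul_smul]
  have hK : ∑ i, ∑ j, ((bilinGram b p)⁻¹ i j * (ξ i * -(s * l))) • p j =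
      (-(s * l)) • (η₀ • e 0 + η₁ • e 1) := by
    rw [← h.sum_gram_inv_smul ξ]
    simp only [Finset.smul_sum, smul_smul]
    refine Finset.sum_congr rfl fun i _ => Finset.sum_congr rfl fun j _ => ?_
    congr 1
    ring
  -- The map `(J ·)^⊤` sends `e 0` to `b (J e 0) (e 1) • e 1` and `e 1` to `-b (J e 0) (e 1) • e 0`.
  -- The orientation sign `s` of the angle variation and this factor combine into `bilinCos`, so the
  -- result does not depend on the orientation of the frame.
  have hT : cxJ (bilinTang b p (cxJ ((-(s * l)) • (η₀ • e 0 + η₁ • e 1)))) =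
      (-(bilinCos b p * l)) • W := by
    rw [h.tang, hW, hc]
    simp only [map_add, map_smul, add_apply, smul_apply, smul_eq_mul, e00, e11, e01]
    match_scalars <;> ring
  rw [hH, hK, hT, h.tang_smul, h.tang_smul]
  module

end IsFrame

/-- Gram-Schmidt: `q` is `p 1` minus its projection on `p 0`, and `α` is the resulting lower
triangular matrix. -/
lemma exists_isFrame {b : CC2 →L[ℝ] CC2 →L[ℝ] ℝ} (hb : IsHermitianForm b) {p : Fin 2 → CC2}
    (hp : LinearIndependent ℝ p) : ∃ e α, IsFrame b p e α := by
  have hp0 : p 0 ≠ 0 := hp.ne_zero 0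
  set t := b (p 1) (p 0) / b (p 0) (p 0) with ht
  have hq : p 1 - t • p 0 ≠ 0 := by
    intro h0
    have := Fintype.linearIndependent_iff.1 hp ![-t, 1] (by
      simp only [Fin.sum_univ_two, Matrix.cons_val_zero, Matrix.cons_val_one]
      rw [← h0]
      module) 1
    simp at this
  have h0 := hb.pos _ hp0
  have h1 := hb.pos _ hq
  have hqp : b (p 1 - t • p 0) (p 0) = 0 := by
    simp only [map_sub, map_smul, sub_apply, smul_apply, smul_eq_mul, ht]
    field_simp
    ring
  have hpq := hqp
  rw [hb.symm] at hpq
  set q := p 1 - t • p 0 with hq'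
  set r := (Real.sqrt (b (p 0) (p 0)))⁻¹ with hr
  set s := (Real.sqrt (b q q))⁻¹ with hs
  have hr2 : r * (r * b (p 0) (p 0)) = 1 := by
    have := Real.mul_self_sqrt h0.le
    have := Real.sqrt_pos.2 h0
    rw [hr]
    field_simp
    linarith
  have hs2 : s * (s * b q q) = 1 := by
    have := Real.mul_self_sqrt h1.le
    have := Real.sqrt_pos.2 h1
    rw [hs]
    field_simp
    linarith
  refine ⟨![r • p 0, s • q], !![r, 0; -s * t, s], ?_, ?_⟩
  · intro k
    fin_cases k <;> simp [Fin.sum_univ_two, hq']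
    module
  · intro i j
    fin_cases i <;> fin_cases j <;> simp [hr2, hs2, hpq, hqp]

/-! ### Tangent and normal spaces, and ellipticity from the form of the symbol -/

section Planes

variable {h : CC2 → CC2 →L[ℝ] CC2 →L[ℝ] ℝ} {f : RR2 → CC2} {y : RR2} {e : Fin 2 → CC2}
  {α : Matrix (Fin 2) (Fin 2) ℝ}

lemma fderiv_eq_sum_pd (f : RR2 → CC2) (y v : RR2) :
    fderiv ℝ f y v = ∑ i, v i • pd i f y := by
  conv_lhs => rw [← (EuclideanSpace.basisFun (Fin 2) ℝ).sum_repr v]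
  simp [pd]

lemma apply_eq_sum_single (ξ : RR2 →L[ℝ] ℝ) (v : RR2) :
    ξ v = ∑ i, v i * ξ (EuclideanSpace.single i 1) := by
  conv_lhs => rw [← (EuclideanSpace.basisFun (Fin 2) ℝ).sum_repr v]
  simp

lemma linearIndependent_pd (hf : Function.Injective (fderiv ℝ f y)) :
    LinearIndependent ℝ (fun i => pd i f y) := by
  have := (EuclideanSpace.basisFun (Fin 2) ℝ).toBasis.linearIndependent.map'
    (fderiv ℝ f y).toLinearMap (LinearMap.ker_eq_bot.2 hf)
  simpa [Function.comp_def, pd] using this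

lemma IsFrame.mem_tangentPlane (hfr : IsFrame (h (f y)) (fun i => pd i f y) e α) (Z : CC2) :
    Z ∈ tangentPlane f y ↔ normPart h f y Z = 0 := by
  set p := fun i => pd i f y with hp
  have hpd : ∀ i, p i ∈ tangentPlane f y := fun i => ⟨_, rfl⟩
  have hn : normPart h f y Z = Z - bilinTang (h (f y)) p Z := rfl
  rw [hn, sub_eq_zero]
  constructor
  · rintro ⟨v, rfl⟩
    -- The coefficients of the projection of `p i` are the `i`-th row of the Gram matrix times its
    -- inverse.
    have hG : ∀ i, bilinTang (h (f y)) p (p i) = p i := by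
      intro i
      have h1 : bilinGram (h (f y)) p * (bilinGram (h (f y)) p)⁻¹ = 1 := by
        rw [hfr.gram_inv, mul_eq_one_comm, Matrix.mul_assoc, mul_eq_one_comm]
        exact hfr.mul_gram_mul
      have h2 : bilinTang (h (f y)) p (p i) =
          ∑ j, (bilinGram (h (f y)) p * (bilinGram (h (f y)) p)⁻¹) i j • p j := by
        rw [bilinTang, Finset.sum_comm]
        refine Finset.sum_congr rfl fun j _ => ?_
        rw [Matrix.mul_apply, Finset.sum_smul]
        exact Finset.sum_congr rfl fun k _ => by rw [mul_comm]; rfl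
      rw [h2, h1]
      simp [Matrix.one_apply]
    change fderiv ℝ f y v = bilinTang (h (f y)) p (fderiv ℝ f y v)
    rw [fderiv_eq_sum_pd, Fin.sum_univ_two, hfr.tang_add, hfr.tang_smul, hfr.tang_smul]
    change _ = v 0 • bilinTang (h (f y)) p (p 0) + v 1 • bilinTang (h (f y)) p (p 1)
    rw [hG, hG]
  · intro hZ
    rw [hZ]
    exact Submodule.sum_mem _ fun i _ => Submodule.sum_mem _ fun j _ =>
      Submodule.smul_mem _ _ (hpd j)

lemma IsFrame.mem_normalSet (hfr : IsFrame (h (f y)) (fun i => pd i f y) e α)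
    (hb : IsHermitianForm (h (f y))) (Z : CC2) :
    Z ∈ normalSet h f y ↔ bilinTang (h (f y)) (fun i => pd i f y) Z = 0 := by
  constructor
  · intro hZ
    refine Finset.sum_eq_zero fun i _ => Finset.sum_eq_zero fun j _ => ?_
    rw [hZ (pd i f y) ⟨_, rfl⟩]
    simp
  · intro hZ X hX
    have h1 := hfr.normal_apply_comm hb Z X
    have h2 : X - bilinTang (h (f y)) (fun i => pd i f y) X = 0 := (hfr.mem_tangentPlane X).1 hX
    rw [hZ, sub_zero, h2] at h1
    simpa using h1

/-- The coordinates of a covector in a frame vanish only if the covector does. -/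
lemma IsFrame.covector_pos (hfr : IsFrame (h (f y)) (fun i => pd i f y) e α)
    {ξ : RR2 →L[ℝ] ℝ} (hξ : ξ ≠ 0) :
    0 < (∑ i, α 0 i * ξ (EuclideanSpace.single i 1)) ^ 2 +
      (∑ i, α 1 i * ξ (EuclideanSpace.single i 1)) ^ 2 := by
  by_contra hneg
  set x : Fin 2 → ℝ := fun i => ξ (EuclideanSpace.single i 1) with hx
  have h0 : ∑ i, α 0 i * x i = 0 := by
    nlinarith [sq_nonneg (∑ i, α 0 i * x i), sq_nonneg (∑ i, α 1 i * x i)]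
  have h1 : ∑ i, α 1 i * x i = 0 := by
    nlinarith [sq_nonneg (∑ i, α 0 i * x i), sq_nonneg (∑ i, α 1 i * x i)]
  have hx0 : x = 0 := Matrix.eq_zero_of_mulVec_eq_zero hfr.det_ne_zero (by
    ext k
    fin_cases k
    exacts [h0, h1])
  apply hξ
  ext v
  rw [apply_eq_sum_single]
  exact Finset.sum_eq_zero fun i _ => by
    rw [show ξ (EuclideanSpace.single i 1) = 0 from congrFun hx0 i, mul_zero]

/-- The quadratic form of the symbol. -/
lemma IsFrame.symbol_apply_self (hfr : IsFrame (h (f y)) (fun i => pd i f y) e α)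
    (hb : IsHermitianForm (h (f y))) (r s : ℝ) (W G : CC2) :
    h (f y) (r • normPart h f y G + (s * h (f y) (normPart h f y G) W) • normPart h f y W) G =
      r * h (f y) (normPart h f y G) (normPart h f y G) +
        s * h (f y) (normPart h f y G) W ^ 2 := by
  have h1 : h (f y) (normPart h f y G) G = h (f y) (normPart h f y G) (normPart h f y G) :=
    hfr.normal_apply_self hb G
  have h2 : h (f y) (normPart h f y W) G = h (f y) (normPart h f y G) W :=
    hfr.normal_apply_comm hb W G
  simp only [map_add, map_smul, add_apply, smul_apply, smul_eq_mul, h1, h2]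
  ring

/-- Coercivity on normal components gives the kernel, and injectivity on the normal space gives
bijectivity there. The nonzero scalar `κ` lets one argument serve both operators: it is `cos α` for
`elOp` and `1` for `normalizedOp`. -/
lemma IsFrame.isEllipticModTangent (hfr : IsFrame (h (f y)) (fun i => pd i f y) e α)
    (hb : IsHermitianForm (h (f y))) {σ : (RR2 →L[ℝ] ℝ) → CC2 →L[ℝ] CC2} {κ β : ℝ} (hκ : κ ≠ 0)
    (hβ : 0 ≤ β) (hc : cosAngle h f y ≠ 0) (W : (RR2 →L[ℝ] ℝ) → CC2)
    (hσ : ∀ ξ G, σ ξ G = κ • ((cosAngle h f y ^ 2 *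
      ((∑ i, α 0 i * ξ (EuclideanSpace.single i 1)) ^ 2 +
      (∑ i, α 1 i * ξ (EuclideanSpace.single i 1)) ^ 2)) • normPart h f y G +
        (β * h (f y) (normPart h f y G) (W ξ)) • normPart h f y (W ξ))) :
    IsEllipticModTangent h f y σ := by
  intro ξ hξ
  have hη := hfr.covector_pos hξ
  have hker : ∀ G, σ ξ G = 0 → normPart h f y G = 0 := by
    intro G hG
    rw [hσ, smul_eq_zero_iff_right hκ] at hG
    -- Pairing `σ ξ G = 0` with `G` gives a vanishing sum of two nonnegative terms, the first of
    -- which is positive if `G^⊥ ≠ 0`.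
    have h1 := hfr.symbol_apply_self hb (cosAngle h f y ^ 2 *
      ((∑ i, α 0 i * ξ (EuclideanSpace.single i 1)) ^ 2 +
      (∑ i, α 1 i * ξ (EuclideanSpace.single i 1)) ^ 2)) β (W ξ) G
    rw [hG] at h1
    by_contra hne
    have h2 := hb.pos _ hne
    have h3 : 0 < cosAngle h f y ^ 2 * ((∑ i, α 0 i * ξ (EuclideanSpace.single i 1)) ^ 2 +
      (∑ i, α 1 i * ξ (EuclideanSpace.single i 1)) ^ 2) *
        h (f y) (normPart h f y G) (normPart h f y G) := by positivity
    have h4 : 0 ≤ β * h (f y) (normPart h f y G) (W ξ) ^ 2 := by positivity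
    simp only [map_zero, zero_apply] at h1
    linarith
  -- The normal space as a submodule, so that injective endomorphisms of it are surjective.
  let V : Submodule ℝ CC2 :=
    { carrier := normalSet h f y
      add_mem' := fun {a b} ha hb X hX => by simp [ha X hX, hb X hX]
      zero_mem' := fun X _ => by simp
      smul_mem' := fun c a ha X hX => by simp [ha X hX] }
  have hnorm : ∀ G, normPart h f y G ∈ V := fun G =>
    (hfr.mem_normalSet hb _).2 (hfr.normal_idem G)
  have hmaps : ∀ G ∈ V, (σ ξ).toLinearMap G ∈ V := fun G _ => by
    change σ ξ G ∈ V
    rw [hσ]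
    exact V.smul_mem _ (V.add_mem (V.smul_mem _ (hnorm _)) (V.smul_mem _ (hnorm _)))
  have hinj : Function.Injective ((σ ξ).toLinearMap.restrict hmaps) := by
    rw [injective_iff_map_eq_zero]
    intro G hG
    have h1 : normPart h f y (G : CC2) = 0 := hker _ (congrArg Subtype.val hG)
    have h2 := (hfr.mem_normalSet hb _).1 G.2
    have h3 : normPart h f y (G : CC2) =
      G - bilinTang (h (f y)) (fun i => pd i f y) (G : CC2) := rfl
    rw [h2, sub_zero, h1] at h3
    exact Subtype.ext h3.symm
  have hsurj := LinearMap.injective_iff_surjective.1 hinj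
  refine ⟨fun G => ⟨fun hG => (hfr.mem_tangentPlane G).2 (hker G hG), fun hG => ?_⟩,
    fun G hG => hmaps G hG, fun G hG G' hG' hGG => ?_, fun G hG => ?_⟩
  · rw [hσ, (hfr.mem_tangentPlane G).1 hG]
    simp
  · exact congrArg Subtype.val (@hinj ⟨G, hG⟩ ⟨G', hG'⟩ (Subtype.ext hGG))
  · obtain ⟨G', hG'⟩ := hsurj ⟨G, hG⟩
    exact ⟨G', G'.2, congrArg Subtype.val hG'⟩

end Planes

/-! ### Operators on jets -/

/-- First order jets of surfaces. -/
abbrev Jet1 := CC2 × (Fin 2 → CC2)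

/-- Second order jets of surfaces. -/
abbrev Jet2 := Jet1 × (Fin 2 → Fin 2 → CC2)

/-- The first order jet of `f` at `y`. -/
def jet1 (f : RR2 → CC2) (y : RR2) : Jet1 := (f y, fun i => pd i f y)

/-- The second order jet of `f` at `y`. -/
def jet2 (f : RR2 → CC2) (y : RR2) : Jet2 := (jet1 f y, fun i j => pd i (pd j f) y)

/-- The operator `G ↦ (0, 0, ξ i * ξ j • G)`. -/
def symbolJet (ξ : RR2 →L[ℝ] ℝ) : CC2 →L[ℝ] Jet2 :=
  (ContinuousLinearMap.inr ℝ Jet1 (Fin 2 → Fin 2 → CC2)).comp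
    (ContinuousLinearMap.pi fun i => ContinuousLinearMap.pi fun j =>
      (ξ (EuclideanSpace.single i 1) * ξ (EuclideanSpace.single j 1)) •
        ContinuousLinearMap.id ℝ CC2)

lemma differentiableAt_pd {f : RR2 → CC2} {y : RR2} (hf : ContDiffAt ℝ 2 f y) (i : Fin 2) :
    DifferentiableAt ℝ (pd i f) y :=
  ((hf.fderiv_right (m := 1) (by norm_num)).clm_apply contDiffAt_const).differentiableAt
    (by norm_num)

lemma pd_add_smul {f v : RR2 → CC2} {y : RR2} (hf : DifferentiableAt ℝ f y)
    (hv : DifferentiableAt ℝ v y) (t : ℝ) (i : Fin 2) :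
    pd i (fun z => f z + t • v z) y = pd i f y + t • pd i v y := by
  have := (hf.hasFDerivAt.add (hv.hasFDerivAt.const_smul t)).fderiv
  exact DFunLike.congr_fun this (EuclideanSpace.single i 1)

/-- The first derivatives must agree on a neighbourhood of `y` before they can be differentiated
again. -/
lemma jet2_add_smul {f v : RR2 → CC2} {y : RR2} (hf : ContDiffAt ℝ 2 f y) (hv : ContDiff ℝ 2 v)
    (t : ℝ) : jet2 (fun z => f z + t • v z) y = jet2 f y + t • jet2 v y := by
  have h1 : ∀ j, pd j (fun z => f z + t • v z) =ᶠ[nhds y] fun z => pd j f z + t • pd j v z := by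
    intro j
    filter_upwards [hf.eventually (by simp)] with z hz
    exact pd_add_smul (hz.differentiableAt (by norm_num))
      (hv.contDiffAt.differentiableAt (by norm_num)) t j
  refine Prod.ext (Prod.ext rfl (funext fun i => (h1 i).eq_of_nhds))
    (funext fun i => funext fun j => ?_)
  have h2 : pd i (pd j fun z => f z + t • v z) y = pd i (fun z => pd j f z + t • pd j v z) y := by
    rw [pd, (h1 j).fderiv_eq, pd]
  exact h2.trans (pd_add_smul (differentiableAt_pd hf j) (differentiableAt_pd hv.contDiffAt j) t i)

/-- An operator which is a differentiable function of the second order jet has a principal symbol,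
the differential of this function in the direction of the second derivatives. -/
lemma hasPrincipalSymbolAt_of_jet {P : (RR2 → CC2) → RR2 → CC2} {f : RR2 → CC2} {y : RR2}
    {Φ : Jet2 → CC2} (hf : ContDiffAt ℝ 2 f y) (hΦ : DifferentiableAt ℝ Φ (jet2 f y))
    (hP : ∀ᶠ x in nhds (jet2 f y), ∀ k, ContDiffAt ℝ 2 k y → jet2 k y = x → P k y = Φ x) :
    HasPrincipalSymbolAt P f y fun ξ => (fderiv ℝ Φ (jet2 f y)).comp (symbolJet ξ) := by
  set D := fderiv ℝ Φ (jet2 f y) with hD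
  let ι := ContinuousLinearMap.inl ℝ Jet1 (Fin 2 → Fin 2 → CC2)
  -- The coefficients are the restrictions of `D` to the coordinate axes of the jet space: second
  -- derivatives, first derivatives, value.
  refine ⟨fun i j => D.comp ((ContinuousLinearMap.inr ℝ Jet1 (Fin 2 → Fin 2 → CC2)).comp
      ((ContinuousLinearMap.single ℝ (fun _ : Fin 2 => Fin 2 → CC2) i).comp
        (ContinuousLinearMap.single ℝ (fun _ : Fin 2 => CC2) j))),
    fun i => D.comp (ι.comp ((ContinuousLinearMap.inr ℝ CC2 (Fin 2 → CC2)).comp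
      (ContinuousLinearMap.single ℝ (fun _ : Fin 2 => CC2) i))),
    D.comp (ι.comp (ContinuousLinearMap.inl ℝ CC2 (Fin 2 → CC2))), ?_, ?_⟩
  · intro v hv
    have hv2 : ContDiff ℝ 2 v := contDiff_infty.1 hv 2
    have hline : HasDerivAt (fun t : ℝ => jet2 f y + t • jet2 v y) (jet2 v y) 0 := by
      simpa using ((hasDerivAt_id (0 : ℝ)).smul_const (jet2 v y)).const_add (jet2 f y)
    have hΦ' : HasFDerivAt Φ D (jet2 f y + (0 : ℝ) • jet2 v y) := by
      simpa using hΦ.hasFDerivAt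
    have hcomp := hΦ'.comp_hasDerivAt (0 : ℝ) hline
    have hcont : Filter.Tendsto (fun t : ℝ => jet2 f y + t • jet2 v y) (nhds 0)
        (nhds (jet2 f y)) := by
      simpa using hline.continuousAt.tendsto
    -- For small `t` the jet of `f + t v` stays where `P` is given by `Φ`, which is all that a
    -- derivative at `0` needs.
    have heq : (fun t : ℝ => P (fun z => f z + t • v z) y) =ᶠ[nhds 0]
        Φ ∘ fun t : ℝ => jet2 f y + t • jet2 v y := by
      filter_upwards [hcont.eventually hP] with t ht
      exact ht _ (hf.add (hv2.contDiffAt.const_smul t)) (jet2_add_smul hf hv2 t)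
    refine (hcomp.congr_of_eventuallyEq heq).congr_deriv ?_
    simp only [ContinuousLinearMap.comp_apply, ← map_sum, ← map_add]
    congr 1
    refine Prod.ext (Prod.ext ?_ ?_) ?_
    · simp [ι, jet2, jet1]
    · ext i : 1
      fin_cases i <;> simp [ι, jet2, jet1, Fin.sum_univ_two]
    · ext i j : 2
      fin_cases i <;> fin_cases j <;> simp [ι, jet2, jet1, Fin.sum_univ_two]
  · intro ξ
    ext1 G
    simp only [ContinuousLinearMap.comp_apply, sum_apply, smul_apply, ← map_sum, ← map_smul]
    congr 1
    refine Prod.ext (Prod.ext ?_ ?_) ?_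
    · simp [symbolJet]
    · simp [symbolJet]
    · ext i j : 2
      fin_cases i <;> fin_cases j <;> simp [symbolJet, Fin.sum_univ_two]

/-! ### The Euler-Lagrange operator on jets -/

/-- The Kähler angle as a function of the first order jet. -/
def jetCos (h : CC2 → CC2 →L[ℝ] CC2 →L[ℝ] ℝ) (x : Jet1) : ℝ := bilinCos (h x.1) x.2

/-- The gradient of `cos α` as a function of the second order jet. -/
def jetGrad (h : CC2 → CC2 →L[ℝ] CC2 →L[ℝ] ℝ) (x : Jet2) : CC2 :=
  ∑ i, ∑ j, ((bilinGram (h x.1.1) x.1.2)⁻¹ i j *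
    fderiv ℝ (jetCos h) x.1 (x.1.2 i, fun k => x.2 i k)) • x.1.2 j

/-- The trace of the second covariant derivative as a function of the second order jet. -/
def jetTrace (h : CC2 → CC2 →L[ℝ] CC2 →L[ℝ] ℝ) (x : Jet2) : CC2 :=
  ∑ i, ∑ j, (bilinGram (h x.1.1) x.1.2)⁻¹ i j •
    (x.2 i j + christoffel h x.1.1 (x.1.2 i) (x.1.2 j))

/-- The normal projection as a function of the first order jet. -/
def jetNorm (h : CC2 → CC2 →L[ℝ] CC2 →L[ℝ] ℝ) (x : Jet1) (Z : CC2) : CC2 :=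
  Z - bilinTang (h x.1) x.2 Z

/-- The Euler-Lagrange operator as a function of the second order jet. -/
def jetOp (h : CC2 → CC2 →L[ℝ] CC2 →L[ℝ] ℝ) (β : ℝ) (x : Jet2) : CC2 :=
  jetCos h x.1 ^ 3 • jetNorm h x.1 (jetTrace h x) -
    β • jetNorm h x.1 (cxJ (bilinTang (h x.1.1) x.1.2 (cxJ (jetGrad h x))))

lemma hasFDerivAt_jet1 {f : RR2 → CC2} {y : RR2} (hf : ContDiffAt ℝ 2 f y) :
    HasFDerivAt (jet1 f) ((fderiv ℝ f y).prod
      (ContinuousLinearMap.pi fun i => fderiv ℝ (pd i f) y)) y :=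
  (hf.differentiableAt (by norm_num)).hasFDerivAt.prodMk
    (hasFDerivAt_pi.2 fun i => (differentiableAt_pd hf i).hasFDerivAt)

/-- Only `∇ cos α` is not literally a function of the jet; the chain rule for `cosAngle h f = jetCos
h ∘ jet1 f` makes it one. The other terms agree by definition. -/
lemma elOp_eq_jetOp {h : CC2 → CC2 →L[ℝ] CC2 →L[ℝ] ℝ} {f : RR2 → CC2} {y : RR2}
    (hf : ContDiffAt ℝ 2 f y) (hc : DifferentiableAt ℝ (jetCos h) (jet1 f y)) (β : ℝ) :
    elOp h f y β = jetOp h β (jet2 f y) := by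
  have hpd : ∀ i, pd i (cosAngle h f) y =
      fderiv ℝ (jetCos h) (jet1 f y) (pd i f y, fun j => pd i (pd j f) y) := by
    intro i
    have h1 : cosAngle h f = jetCos h ∘ jet1 f := rfl
    rw [h1, pd, (hc.hasFDerivAt.comp y (hasFDerivAt_jet1 hf)).fderiv]
    rfl
  have hg : gradCos h f y = jetGrad h (jet2 f y) := by
    simp only [gradCos, hpd]
    rfl
  rw [elOp, hg]
  rfl

/-! ### Regularity of the jet functions -/

section Smoothness

variable {h : CC2 → CC2 →L[ℝ] CC2 →L[ℝ] ℝ} {x : Jet1}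

lemma contDiffAt_bilinGram {n : WithTop ℕ∞} (hh : ContDiffAt ℝ n h x.1) (i j : Fin 2) :
    ContDiffAt ℝ n (fun z : Jet1 => bilinGram (h z.1) z.2 i j) x := by
  have h1 : ContDiffAt ℝ n (fun z : Jet1 => h z.1) x := hh.comp x contDiffAt_fst
  have h2 : ∀ i, ContDiffAt ℝ n (fun z : Jet1 => z.2 i) x := fun i => by fun_prop
  exact (h1.clm_apply (h2 i)).clm_apply (h2 j)

lemma contDiffAt_det_bilinGram {n : WithTop ℕ∞} (hh : ContDiffAt ℝ n h x.1) :
    ContDiffAt ℝ n (fun z : Jet1 => (bilinGram (h z.1) z.2).det) x := by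
  simp only [Matrix.det_fin_two]
  exact ((contDiffAt_bilinGram hh 0 0).mul (contDiffAt_bilinGram hh 1 1)).sub
    ((contDiffAt_bilinGram hh 0 1).mul (contDiffAt_bilinGram hh 1 0))

/-- This adjugate formula also holds for a singular Gram matrix, so it can be rewritten under the
binder before differentiating. -/
lemma bilinGram_inv (b : CC2 →L[ℝ] CC2 →L[ℝ] ℝ) (p : Fin 2 → CC2) :
    (bilinGram b p)⁻¹ = (bilinGram b p).det⁻¹ • !![bilinGram b p 1 1, -bilinGram b p 0 1;
      -bilinGram b p 1 0, bilinGram b p 0 0] := by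
  rw [Matrix.inv_def, Ring.inverse_eq_inv', Matrix.adjugate_fin_two]

lemma contDiffAt_bilinGram_inv {n : WithTop ℕ∞} (hh : ContDiffAt ℝ n h x.1)
    (hd : (bilinGram (h x.1) x.2).det ≠ 0) (i j : Fin 2) :
    ContDiffAt ℝ n (fun z : Jet1 => (bilinGram (h z.1) z.2)⁻¹ i j) x := by
  have hG := contDiffAt_bilinGram hh
  simp only [bilinGram_inv, Matrix.smul_apply, smul_eq_mul]
  refine ((contDiffAt_det_bilinGram hh).inv hd).mul ?_
  fin_cases i <;> fin_cases j
  exacts [hG 1 1, (hG 0 1).neg, (hG 1 0).neg, hG 0 0]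

lemma contDiffAt_jetCos {n : WithTop ℕ∞} (hh : ContDiffAt ℝ n h x.1)
    (hd : 0 < (bilinGram (h x.1) x.2).det) : ContDiffAt ℝ n (jetCos h) x := by
  have h1 : ContDiffAt ℝ n (fun z : Jet1 => h z.1) x := hh.comp x contDiffAt_fst
  have h2 : ∀ i, ContDiffAt ℝ n (fun z : Jet1 => z.2 i) x := fun i => by fun_prop
  have h3 : ContDiffAt ℝ n (fun z : Jet1 => h z.1 (cxJ (z.2 0)) (z.2 1)) x :=
    (h1.clm_apply (cxJ.contDiff.contDiffAt.comp x (h2 0))).clm_apply (h2 1)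
  exact h3.div ((contDiffAt_det_bilinGram hh).sqrt hd.ne') (Real.sqrt_pos.2 hd).ne'

/-- A positive definite form is injective as a map to the dual, hence invertible by equality of
dimensions, and inversion is smooth at invertible maps. -/
lemma contDiffAt_inverse {n : WithTop ℕ∞} {u : CC2} (hh : ContDiffAt ℝ n h u)
    (hb : IsHermitianForm (h u)) : ContDiffAt ℝ n (fun z => (h z).inverse) u := by
  have hinj : Function.Injective (h u).toLinearMap := by
    rw [injective_iff_map_eq_zero]
    intro X hX
    by_contra hne
    have := hb.pos X hne
    rw [show h u X = 0 from hX] at this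
    simp at this
  have hfin : Module.finrank ℝ CC2 = Module.finrank ℝ (CC2 →L[ℝ] ℝ) := by
    rw [← LinearMap.toContinuousLinearMap.finrank_eq]
    exact (Subspace.dual_finrank_eq).symm
  let E := (LinearEquiv.ofInjectiveOfFinrankEq (h u).toLinearMap hinj hfin).toContinuousLinearEquiv
  have hE : (h u).IsInvertible := ⟨E, by ext; rfl⟩
  exact (hE.contDiffAt_map_inverse).comp u hh

set_option maxSynthPendingDepth 5 in
lemma differentiableAt_christoffel (hh : ContDiffAt ℝ 2 h x.1) (hb : IsHermitianForm (h x.1))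
    (i j : Fin 2) :
    DifferentiableAt ℝ (fun z : Jet1 => christoffel h z.1 (z.2 i) (z.2 j)) x := by
  have h1 : DifferentiableAt ℝ (fun z : Jet1 => (h z.1).inverse) x :=
    ((contDiffAt_inverse hh hb).differentiableAt (by norm_num)).comp (f := Prod.fst) x
      differentiableAt_fst
  have hd : DifferentiableAt ℝ (fderiv ℝ h) x.1 :=
    (hh.fderiv_right (m := 1) (by norm_num)).differentiableAt (by norm_num)
  have h2 : DifferentiableAt ℝ (fun z : Jet1 => fderiv ℝ h z.1) x :=
    hd.comp (f := Prod.fst) x differentiableAt_fst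
  have h3 : ∀ i, DifferentiableAt ℝ (fun z : Jet1 => z.2 i) x := fun i => by fun_prop
  have h4 : DifferentiableAt ℝ (fun z : Jet1 => (fderiv ℝ h z.1).flip) x :=
    ((ContinuousLinearMap.flipₗᵢ ℝ CC2 CC2 (CC2 →L[ℝ] ℝ)).differentiable.differentiableAt).comp x h2
  have h5 : DifferentiableAt ℝ (fun z : Jet1 => ((fderiv ℝ h z.1).flip (z.2 i)).flip) x :=
    ((ContinuousLinearMap.flipₗᵢ ℝ CC2 CC2 ℝ).differentiable.differentiableAt).comp x
      (h4.clm_apply (h3 i))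
  have h6 := (((h2.clm_apply (h3 i)).clm_apply (h3 j)).fun_add
    ((h2.clm_apply (h3 j)).clm_apply (h3 i))).fun_sub (h5.clm_apply (h3 j))
  exact h1.clm_apply (h6.fun_const_smul (1 / 2 : ℝ))

lemma differentiableAt_bilinTang (hh : ContDiffAt ℝ 1 h x.1)
    (hd : (bilinGram (h x.1) x.2).det ≠ 0) {q : Fin 2 → Fin 2 → CC2} {Z : Jet2 → CC2}
    (hZ : DifferentiableAt ℝ Z (x, q)) :
    DifferentiableAt ℝ (fun z : Jet2 => bilinTang (h z.1.1) z.1.2 (Z z)) (x, q) := by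
  have h1 : DifferentiableAt ℝ (fun z : Jet2 => h z.1.1) (x, q) :=
    (hh.differentiableAt one_ne_zero).comp (f := fun z : Jet2 => z.1.1) (x, q) (by fun_prop)
  have h2 : ∀ i j, DifferentiableAt ℝ
      (fun z : Jet2 => (bilinGram (h z.1.1) z.1.2)⁻¹ i j) (x, q) := fun i j =>
    ((contDiffAt_bilinGram_inv hh hd i j).differentiableAt one_ne_zero).comp
      (f := Prod.fst) (x, q) differentiableAt_fst
  have h3 : ∀ i, DifferentiableAt ℝ (fun z : Jet2 => z.1.2 i) (x, q) := fun i => by fun_prop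
  exact .fun_sum fun i _ => .fun_sum fun j _ =>
    ((h2 i j).mul ((h1.clm_apply hZ).clm_apply (h3 i))).smul (h3 j)

lemma differentiableAt_jetOp (hh : ContDiffAt ℝ 2 h x.1) (hb : IsHermitianForm (h x.1))
    (hd : 0 < (bilinGram (h x.1) x.2).det) (β : ℝ) (q : Fin 2 → Fin 2 → CC2) :
    DifferentiableAt ℝ (jetOp h β) (x, q) := by
  have hh1 : ContDiffAt ℝ 1 h x.1 := hh.of_le (by norm_num)
  have h2 : ∀ i j, DifferentiableAt ℝ
      (fun z : Jet2 => (bilinGram (h z.1.1) z.1.2)⁻¹ i j) (x, q) := fun i j =>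
    ((contDiffAt_bilinGram_inv hh1 hd.ne' i j).differentiableAt one_ne_zero).comp
      (f := Prod.fst) (x, q) differentiableAt_fst
  have h3 : ∀ i, DifferentiableAt ℝ (fun z : Jet2 => z.1.2 i) (x, q) := fun i => by fun_prop
  have h4 : ∀ i j, DifferentiableAt ℝ (fun z : Jet2 => z.2 i j) (x, q) := fun i j => by fun_prop
  have hC := contDiffAt_jetCos hh hd
  have h5 : DifferentiableAt ℝ (fun z : Jet2 => jetCos h z.1) (x, q) :=
    (hC.differentiableAt (by norm_num)).comp (f := Prod.fst) (x, q) differentiableAt_fst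
  have h6 : DifferentiableAt ℝ (fun z : Jet2 => fderiv ℝ (jetCos h) z.1) (x, q) :=
    ((hC.fderiv_right (m := 1) (by norm_num)).differentiableAt one_ne_zero).comp
      (f := Prod.fst) (x, q) differentiableAt_fst
  have h7 : ∀ i j, DifferentiableAt ℝ
      (fun z : Jet2 => christoffel h z.1.1 (z.1.2 i) (z.1.2 j)) (x, q) := fun i j =>
    (differentiableAt_christoffel hh hb i j).comp (f := Prod.fst) (x, q)
      differentiableAt_fst
  have hT : DifferentiableAt ℝ (jetTrace h) (x, q) := .fun_sum fun i _ => .fun_sum fun j _ =>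
    (h2 i j).smul ((h4 i j).add (h7 i j))
  have hG : DifferentiableAt ℝ (jetGrad h) (x, q) := .fun_sum fun i _ => .fun_sum fun j _ =>
    ((h2 i j).mul (h6.clm_apply ((h3 i).prodMk
      (differentiableAt_pi.2 fun k => h4 i k)))).smul (h3 j)
  have hJ : ∀ {Z : Jet2 → CC2}, DifferentiableAt ℝ Z (x, q) →
      DifferentiableAt ℝ (fun z => cxJ (Z z)) (x, q) := fun hZ =>
    cxJ.differentiableAt.comp (x, q) hZ
  have hN : ∀ {Z : Jet2 → CC2}, DifferentiableAt ℝ Z (x, q) →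
      DifferentiableAt ℝ (fun z => jetNorm h z.1 (Z z)) (x, q) := fun hZ =>
    hZ.sub (differentiableAt_bilinTang hh1 hd.ne' hZ)
  exact ((h5.pow 3).smul (hN hT)).sub
    ((hN (hJ (differentiableAt_bilinTang hh1 hd.ne' (hJ hG)))).const_smul β)

end Smoothness

/-! ### The differential of the jet operator in symbol directions -/

section Symbol

variable {h : CC2 → CC2 →L[ℝ] CC2 →L[ℝ] ℝ} {x : Jet1}

lemma hasDerivAt_quadratic (a b c : ℝ) : HasDerivAt (fun t : ℝ => a + t * b + t ^ 2 * c) b 0 := by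
  have h1 := (((hasDerivAt_id (0 : ℝ)).mul_const b).const_add a).add
    ((hasDerivAt_pow 2 (0 : ℝ)).mul_const c)
  exact h1.congr_deriv (by simp)

/-- Along the line in direction `(0, ξ k • G)` the base point is fixed, so the Gram entries and the
numerator are quadratic in `t`. The quotient rule and uniqueness of derivatives then apply; the
subtracted sum is the logarithmic derivative of the area element. -/
lemma fderiv_jetCos_vertical (hh : ContDiffAt ℝ 1 h x.1) (hb : IsHermitianForm (h x.1))
    (hd : 0 < (bilinGram (h x.1) x.2).det) (ξ : Fin 2 → ℝ) (G : CC2) :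
    fderiv ℝ (jetCos h) x (0, fun k => ξ k • G) =
      (ξ 0 * h x.1 (cxJ G) (x.2 1) + ξ 1 * h x.1 (cxJ (x.2 0)) G) /
          Real.sqrt (bilinGram (h x.1) x.2).det -
        bilinCos (h x.1) x.2 *
          ∑ i, ∑ j, (bilinGram (h x.1) x.2)⁻¹ i j * (ξ i * h x.1 G (x.2 j)) := by
  set b := h x.1 with hbdef
  set p := x.2 with hp
  have hgram : ∀ i j, HasDerivAt (fun t : ℝ => bilinGram b (fun k => p k + t • ξ k • G) i j)
      (ξ i * b G (p j) + ξ j * b G (p i)) 0 := by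
    intro i j
    refine (hasDerivAt_quadratic (b (p i) (p j)) (ξ i * b G (p j) + ξ j * b G (p i))
      (ξ i * ξ j * b G G)).congr_of_eventuallyEq (.of_forall fun t => ?_)
    simp only [bilinGram, Matrix.of_apply, map_add, map_smul, add_apply, smul_apply, smul_eq_mul,
      hb.symm (p i) G]
    ring
  have hnum : HasDerivAt (fun t : ℝ => b (cxJ (p 0 + t • ξ 0 • G)) (p 1 + t • ξ 1 • G))
      (ξ 0 * b (cxJ G) (p 1) + ξ 1 * b (cxJ (p 0)) G) 0 := by
    refine (hasDerivAt_quadratic (b (cxJ (p 0)) (p 1)) _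
      (ξ 0 * ξ 1 * b (cxJ G) G)).congr_of_eventuallyEq (.of_forall fun t => ?_)
    simp only [map_add, map_smul, add_apply, smul_apply, smul_eq_mul]
    ring
  have hdet := ((hgram 0 0).mul (hgram 1 1)).sub ((hgram 0 1).mul (hgram 1 0))
  have hdet' : HasDerivAt (fun t : ℝ => (bilinGram b (fun k => p k + t • ξ k • G)).det) _ 0 :=
    hdet.congr_of_eventuallyEq (.of_forall fun t => Matrix.det_fin_two _)
  have hp0 : (fun k => p k + (0 : ℝ) • ξ k • G) = p := by simp
  have hdet0 : (bilinGram b (fun k => p k + (0 : ℝ) • ξ k • G)).det ≠ 0 := by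
    rw [hp0]
    exact hd.ne'
  have hsq := hdet'.sqrt hdet0
  have hquot := hnum.div hsq (by rw [hp0]; exact (Real.sqrt_pos.2 hd).ne')
  have hline : HasDerivAt (fun t : ℝ => x + t • ((0, fun k => ξ k • G) : Jet1))
      (0, fun k => ξ k • G) 0 := by
    simpa using ((hasDerivAt_id (0 : ℝ)).smul_const ((0, fun k => ξ k • G) : Jet1)).const_add x
  have hC : HasFDerivAt (jetCos h) (fderiv ℝ (jetCos h) x)
      (x + (0 : ℝ) • ((0, fun k => ξ k • G) : Jet1)) := by
    simpa using ((contDiffAt_jetCos hh hd).differentiableAt one_ne_zero).hasFDerivAt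
  have hcomp := hC.comp_hasDerivAt (0 : ℝ) hline
  have heq : jetCos h ∘ (fun t : ℝ => x + t • ((0, fun k => ξ k • G) : Jet1)) =
      fun t : ℝ => b (cxJ (p 0 + t • ξ 0 • G)) (p 1 + t • ξ 1 • G) /
        Real.sqrt (bilinGram b (fun k => p k + t • ξ k • G)).det := by
    funext t
    have h0 : (x + t • ((0, fun k => ξ k • G) : Jet1)).1 = x.1 := by simp
    have h1 : (x + t • ((0, fun k => ξ k • G) : Jet1)).2 = fun k => p k + t • ξ k • G := rfl
    rw [Function.comp, jetCos, bilinCos, h0, h1]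
  rw [heq] at hcomp
  rw [hcomp.unique hquot]
  simp only [zero_smul, add_zero, bilinCos, bilinGram_inv, Fin.sum_univ_two, Matrix.smul_apply,
    smul_eq_mul]
  have hS := Real.sq_sqrt hd.le
  have hSp := Real.sqrt_pos.2 hd
  -- With the determinant expressed through its square root, the identity becomes rational in a
  -- single radical.
  rw [show (bilinGram b p).det⁻¹ = (Real.sqrt (bilinGram b p).det ^ 2)⁻¹ by rw [hS]]
  simp only [bilinGram, Matrix.of_apply, Matrix.cons_val', Matrix.cons_val_zero,
    Matrix.cons_val_one, Matrix.cons_val_fin_one, hb.symm (p 1) (p 0)] at hSp ⊢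
  field_simp
  ring

lemma fderiv_jetOp_symbolJet (hh : ContDiffAt ℝ 2 h x.1) (hb : IsHermitianForm (h x.1))
    {e : Fin 2 → CC2} {α : Matrix (Fin 2) (Fin 2) ℝ} (hfr : IsFrame (h x.1) x.2 e α) (β : ℝ)
    (q : Fin 2 → Fin 2 → CC2) (ξ : RR2 →L[ℝ] ℝ) (G : CC2) :
    fderiv ℝ (jetOp h β) (x, q) (symbolJet ξ G) =
      elSymbol (h x.1) x.2 β (fun i => ξ (EuclideanSpace.single i 1)) G := by
  set η : Fin 2 → ℝ := fun i => ξ (EuclideanSpace.single i 1) with hη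
  have hd : 0 < (bilinGram (h x.1) x.2).det := by
    have := hfr.det_sq_mul
    exact pos_of_mul_pos_right (by rw [this]; exact one_pos) (sq_nonneg _)
  have hline : HasDerivAt (fun t : ℝ => ((x, q) : Jet2) + t • symbolJet ξ G) (symbolJet ξ G) 0 := by
    simpa using ((hasDerivAt_id (0 : ℝ)).smul_const (symbolJet ξ G)).const_add ((x, q) : Jet2)
  have hΦ : HasFDerivAt (jetOp h β) (fderiv ℝ (jetOp h β) (x, q))
      (((x, q) : Jet2) + (0 : ℝ) • symbolJet ξ G) := by
    simpa using (differentiableAt_jetOp hh hb hd β q).hasFDerivAt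
  have hcomp := hΦ.comp_hasDerivAt (0 : ℝ) hline
  have hsymb : ∀ t : ℝ, ((x, q) : Jet2) + t • symbolJet ξ G =
      (x, fun i j => q i j + t • (η i * η j) • G) := by
    intro t
    refine Prod.ext ?_ rfl
    simp [symbolJet]
  have htrace : ∀ t : ℝ, jetTrace h (((x, q) : Jet2) + t • symbolJet ξ G) = jetTrace h (x, q) +
      t • ∑ i, ∑ j, (bilinGram (h x.1) x.2)⁻¹ i j • (η i * η j) • G := by
    intro t
    rw [hsymb]
    simp only [jetTrace, Fin.sum_univ_two]
    module
  have hgrad : ∀ t : ℝ, jetGrad h (((x, q) : Jet2) + t • symbolJet ξ G) = jetGrad h (x, q) +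
      t • ∑ i, ∑ j, ((bilinGram (h x.1) x.2)⁻¹ i j *
        (η i * fderiv ℝ (jetCos h) x (0, fun k => η k • G))) • x.2 j := by
    intro t
    rw [hsymb]
    -- Row `i` of the varied second derivatives is `η i` times the vertical direction `η k • G`, so
    -- the gradient inherits the variation of the angle.
    have hlin : ∀ i, fderiv ℝ (jetCos h) x (x.2 i, fun k => q i k + t • (η i * η k) • G) =
        fderiv ℝ (jetCos h) x (x.2 i, fun k => q i k) +
          t * (η i * fderiv ℝ (jetCos h) x (0, fun k => η k • G)) := by
      intro i
      rw [← smul_eq_mul, ← smul_eq_mul, ← map_smul, ← map_smul, ← map_add]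
      congr 1
      refine Prod.ext (by simp) (funext fun k => ?_)
      simp [mul_smul]
    simp only [jetGrad, hlin, Fin.sum_univ_two]
    module
  -- The operator is quasilinear: with the first jet fixed it is affine in the second derivatives,
  -- so its derivative is the slope.
  have haff : jetOp h β ∘ (fun t : ℝ => ((x, q) : Jet2) + t • symbolJet ξ G) =
      fun t => jetOp h β (x, q) + t • elSymbol (h x.1) x.2 β η G := by
    funext t
    have h1 : (((x, q) : Jet2) + t • symbolJet ξ G).1 = x := by rw [hsymb]
    rw [Function.comp, jetOp, htrace, hgrad, h1,
      fderiv_jetCos_vertical (hh.of_le (by norm_num)) hb hd]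
    simp only [jetOp, elSymbol, jetNorm, jetCos, map_add, map_smul, hfr.tang_add, hfr.tang_smul]
    module
  rw [haff] at hcomp
  refine hcomp.unique ?_
  simpa using ((hasDerivAt_id (0 : ℝ)).smul_const (elSymbol (h x.1) x.2 β η G)).const_add
    (jetOp h β (x, q))

end Symbol

/-! ### Differentials of charts are injective -/

section Charts

variable {E : Type*} [NormedAddCommGroup E] [NormedSpace ℝ E] {N : Type*} [TopologicalSpace N]
  [ChartedSpace E N]

lemma mfderiv_chart_symm_injective {ψ : OpenPartialHomeomorph N E}
    (hψ : ψ ∈ IsManifold.maximalAtlas 𝓘(ℝ, E) ∞ N) {u : E} (hu : u ∈ ψ.target) :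
    Function.Injective (mfderiv 𝓘(ℝ, E) 𝓘(ℝ, E) ψ.symm u) := by
  have h1 : MDifferentiableAt 𝓘(ℝ, E) 𝓘(ℝ, E) ψ.symm u :=
    (contMDiffAt_symm_of_mem_maximalAtlas hψ hu).mdifferentiableAt (by simp)
  have h2 : MDifferentiableAt 𝓘(ℝ, E) 𝓘(ℝ, E) ψ (ψ.symm u) :=
    (contMDiffAt_of_mem_maximalAtlas hψ (ψ.map_target hu)).mdifferentiableAt (by simp)
  have h3 : mfderiv 𝓘(ℝ, E) 𝓘(ℝ, E) (ψ ∘ ψ.symm) u = ContinuousLinearMap.id ℝ _ := by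
    rw [← mfderiv_id (x := u)]
    apply Filter.EventuallyEq.mfderiv_eq
    filter_upwards [ψ.open_target.mem_nhds hu] with z hz
    simp [ψ.right_inv hz]
  rw [mfderiv_comp u h2 h1] at h3
  exact Function.LeftInverse.injective (g := mfderiv 𝓘(ℝ, E) 𝓘(ℝ, E) ψ (ψ.symm u))
    fun v => DFunLike.congr_fun h3 v

lemma mfderiv_chart_injective {ψ : OpenPartialHomeomorph N E}
    (hψ : ψ ∈ IsManifold.maximalAtlas 𝓘(ℝ, E) ∞ N) {q : N} (hq : q ∈ ψ.source) :
    Function.Injective (mfderiv 𝓘(ℝ, E) 𝓘(ℝ, E) ψ q) := by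
  have h1 : MDifferentiableAt 𝓘(ℝ, E) 𝓘(ℝ, E) ψ q :=
    (contMDiffAt_of_mem_maximalAtlas hψ hq).mdifferentiableAt (by simp)
  have h2 : MDifferentiableAt 𝓘(ℝ, E) 𝓘(ℝ, E) ψ.symm (ψ q) :=
    (contMDiffAt_symm_of_mem_maximalAtlas hψ (ψ.map_source hq)).mdifferentiableAt (by simp)
  have h3 : mfderiv 𝓘(ℝ, E) 𝓘(ℝ, E) (ψ.symm ∘ ψ) q = mfderiv 𝓘(ℝ, E) 𝓘(ℝ, E) id q := by
    apply Filter.EventuallyEq.mfderiv_eq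
    filter_upwards [ψ.open_source.mem_nhds hq] with z hz
    simp [ψ.left_inv hz]
  rw [mfderiv_comp q h2 h1, mfderiv_id] at h3
  exact Function.LeftInverse.injective (g := mfderiv 𝓘(ℝ, E) 𝓘(ℝ, E) ψ.symm (ψ q))
    fun v => DFunLike.congr_fun h3 v

end Charts

/-! ### The Kähler metric and the surface in holomorphic charts -/

section Manifold

variable {M : Type*} [TopologicalSpace M] [ChartedSpace CC2 M] [IsManifold 𝓘(ℂ, CC2) ∞ M]

lemma mem_contDiffGroupoid_real {e : OpenPartialHomeomorph CC2 CC2}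
    (he : e ∈ contDiffGroupoid ∞ 𝓘(ℂ, CC2)) : e ∈ contDiffGroupoid ∞ 𝓘(ℝ, CC2) := by
  have h1 := (contMDiffOn_iff_contDiffOn.1
    (contMDiffOn_of_mem_contDiffGroupoid he)).restrict_scalars ℝ
  have h2 := (contMDiffOn_iff_contDiffOn.1 (contMDiffOn_of_mem_contDiffGroupoid
    ((contDiffGroupoid ∞ 𝓘(ℂ, CC2)).symm he))).restrict_scalars ℝ
  rw [contDiffGroupoid, mem_groupoid_of_pregroupoid]
  simpa [contDiffPregroupoid] using And.intro h1 h2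

omit [IsManifold 𝓘(ℂ, CC2) ∞ M] in
lemma mem_maximalAtlas_real {ψ : OpenPartialHomeomorph M CC2}
    (hψ : ψ ∈ IsManifold.maximalAtlas 𝓘(ℂ, CC2) ∞ M) :
    ψ ∈ IsManifold.maximalAtlas 𝓘(ℝ, CC2) ∞ M := by
  intro e' he'
  have := hψ e' he'
  exact ⟨mem_contDiffGroupoid_real this.1, mem_contDiffGroupoid_real this.2⟩

omit [IsManifold 𝓘(ℂ, CC2) ∞ M] in
/-- The differential of the inverse of a holomorphic chart is complex linear. -/
lemma mfderiv_symm_cxJ {ψ : OpenPartialHomeomorph M CC2}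
    (hψ : ψ ∈ IsManifold.maximalAtlas 𝓘(ℂ, CC2) ∞ M) {u : CC2} (hu : u ∈ ψ.target) (v : CC2) :
    (mfderiv 𝓘(ℝ, CC2) 𝓘(ℝ, CC2) ψ.symm u : CC2 →L[ℝ] CC2) (cxJ v) =
      cxJ ((mfderiv 𝓘(ℝ, CC2) 𝓘(ℝ, CC2) ψ.symm u : CC2 →L[ℝ] CC2) v) := by
  have hc : MDifferentiableAt 𝓘(ℂ, CC2) 𝓘(ℂ, CC2) ψ.symm u :=
    (contMDiffAt_symm_of_mem_maximalAtlas hψ hu).mdifferentiableAt (by simp)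
  have hr : MDifferentiableAt 𝓘(ℝ, CC2) 𝓘(ℝ, CC2) ψ.symm u :=
    (contMDiffAt_symm_of_mem_maximalAtlas (mem_maximalAtlas_real hψ) hu).mdifferentiableAt
      (by simp)
  have hd := hc.2
  simp only [mfld_simps, DifferentiableWithinAtProp] at hd
  -- The tangent space at a point is modelled by its preferred chart, so the real differential is
  -- that of a transition map, which is complex differentiable.
  have key : (mfderiv 𝓘(ℝ, CC2) 𝓘(ℝ, CC2) ψ.symm u : CC2 →L[ℝ] CC2) =
      (fderiv ℂ (chartAt CC2 (ψ.symm u) ∘ ψ.symm) u).restrictScalars ℝ := by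
    have hw : (mfderiv 𝓘(ℝ, CC2) 𝓘(ℝ, CC2) ψ.symm u : CC2 →L[ℝ] CC2) =
        fderivWithin ℝ (writtenInExtChartAt 𝓘(ℝ, CC2) 𝓘(ℝ, CC2) u ψ.symm)
          (Set.range 𝓘(ℝ, CC2)) (extChartAt 𝓘(ℝ, CC2) u u) := if_pos hr
    rw [hw]
    simp only [mfld_simps, fderivWithin_univ]
    exact DifferentiableAt.fderiv_restrictScalars ℝ (differentiableWithinAt_univ.1 hd)
  rw [key]
  exact ContinuousLinearMap.map_smul (fderiv ℂ (chartAt CC2 (ψ.symm u) ∘ ψ.symm) u) Complex.I v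

lemma contDiffOn_chart (g : KahlerMetric M) {ψ : OpenPartialHomeomorph M CC2}
    (hψ : ψ ∈ IsManifold.maximalAtlas 𝓘(ℝ, CC2) ∞ M) :
    ContDiffOn ℝ ∞ (g.chart ψ) ψ.target := by
  have hs : ContMDiffOn 𝓘(ℝ, CC2) 𝓘(ℝ, CC2) ∞ ψ.symm ψ.target :=
    contMDiffOn_symm_of_mem_maximalAtlas hψ
  have hu : UniqueMDiffOn 𝓘(ℝ, CC2) ψ.target := ψ.open_target.uniqueMDiffOn
  have ht := hs.contMDiffOn_tangentMapWithin (m := ∞) le_rfl hu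
  -- Constant fields pushed forward by the tangent map of `ψ.symm` are smooth. Pairing two of them
  -- by the metric gives its coefficients, whose smoothness suffices in finite dimension.
  have hv : ∀ v : CC2, ContMDiffOn 𝓘(ℝ, CC2) 𝓘(ℝ, CC2).tangent ∞
      (fun u => (⟨ψ.symm u, mfderiv 𝓘(ℝ, CC2) 𝓘(ℝ, CC2) ψ.symm u v⟩ :
        TangentBundle 𝓘(ℝ, CC2) M)) ψ.target := by
    intro v
    have hsec : ContMDiffOn 𝓘(ℝ, CC2) 𝓘(ℝ, CC2).tangent ∞
        (fun u => (⟨u, v⟩ : TangentBundle 𝓘(ℝ, CC2) CC2)) ψ.target := by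
      intro u _
      exact ContMDiffAt.contMDiffWithinAt
        ((contMDiffAt_vectorSpace_iff_contDiffAt
          (V := fun z : CC2 => (v : TangentSpace 𝓘(ℝ, CC2) z))).2 contDiffAt_const)
    refine (ht.comp hsec fun u hu => hu).congr fun u hu' => ?_
    simp only [Function.comp, tangentMapWithin]
    rw [mfderivWithin_of_mem_nhds (ψ.open_target.mem_nhds hu')]
  have hg := (g.contMDiff.comp_contMDiffOn hs)
  refine contDiffOn_clm_apply.2 fun v => contDiffOn_clm_apply.2 fun w => ?_
  have := ContMDiffOn.clm_bundle_apply₂ (F₁ := CC2) (F₂ := CC2) (F₃ := ℝ)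
    (E₁ := fun p : M => TangentSpace 𝓘(ℝ, CC2) p) (E₂ := fun p : M => TangentSpace 𝓘(ℝ, CC2) p)
    (E₃ := fun p : M => ℝ)
    (b := ψ.symm) (ψ := fun u => g.inner (ψ.symm u)) hg (hv v) (hv w)
  intro u hu'
  have h1 := this u hu'
  rw [Bundle.contMDiffWithinAt_totalSpace] at h1
  exact contMDiffWithinAt_iff_contDiffWithinAt.1 h1.2

lemma chart_symm (g : KahlerMetric M) (ψ : OpenPartialHomeomorph M CC2) (u X Y : CC2) :
    g.chart ψ u X Y = g.chart ψ u Y X :=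
  g.symm _ _ _

lemma chart_pos (g : KahlerMetric M) {ψ : OpenPartialHomeomorph M CC2}
    (hψ : ψ ∈ IsManifold.maximalAtlas 𝓘(ℝ, CC2) ∞ M) {u : CC2} (hu : u ∈ ψ.target) {X : CC2}
    (hX : X ≠ 0) : 0 < g.chart ψ u X X :=
  g.pos _ _ fun h => hX (mfderiv_chart_symm_injective hψ hu (h.trans (map_zero _).symm))

lemma chart_cxJ (g : KahlerMetric M) {ψ : OpenPartialHomeomorph M CC2}
    (hψ : ψ ∈ IsManifold.maximalAtlas 𝓘(ℂ, CC2) ∞ M) {u : CC2} (hu : u ∈ ψ.target) (X Y : CC2) :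
    g.chart ψ u (cxJ X) (cxJ Y) = g.chart ψ u X Y := by
  have hX := mfderiv_symm_cxJ hψ hu X
  have hY := mfderiv_symm_cxJ hψ hu Y
  exact (congrArg₂ (fun v w => g.inner (ψ.symm u) v w) hX hY).trans (g.inner_J _ _ _)

variable {S : Type*} [TopologicalSpace S] [ChartedSpace RR2 S]

omit [IsManifold 𝓘(ℂ, CC2) ∞ M] in
lemma contDiffAt_localRep {F : S → M} (hF : ContMDiff 𝓘(ℝ, RR2) 𝓘(ℝ, CC2) ∞ F)
    {φ : OpenPartialHomeomorph S RR2} (hφ : φ ∈ IsManifold.maximalAtlas 𝓘(ℝ, RR2) ∞ S)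
    {ψ : OpenPartialHomeomorph M CC2} (hψ : ψ ∈ IsManifold.maximalAtlas 𝓘(ℝ, CC2) ∞ M)
    {p : S} (hp : p ∈ φ.source) (hFp : F p ∈ ψ.source) :
    ContDiffAt ℝ ∞ (localRep F φ ψ) (φ p) := by
  rw [← contMDiffAt_iff_contDiffAt]
  have hs := contMDiffAt_symm_of_mem_maximalAtlas hφ (φ.map_source hp)
  have hFp' : F (φ.symm (φ p)) ∈ ψ.source := by rwa [φ.left_inv hp]
  exact (contMDiffAt_of_mem_maximalAtlas hψ hFp').comp (φ p) ((hF _).comp (φ p) hs)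

omit [IsManifold 𝓘(ℂ, CC2) ∞ M] in
lemma injective_fderiv_localRep {F : S → M} (hF : IsSmoothImmersion F)
    {φ : OpenPartialHomeomorph S RR2} (hφ : φ ∈ IsManifold.maximalAtlas 𝓘(ℝ, RR2) ∞ S)
    {ψ : OpenPartialHomeomorph M CC2} (hψ : ψ ∈ IsManifold.maximalAtlas 𝓘(ℝ, CC2) ∞ M)
    {p : S} (hp : p ∈ φ.source) (hFp : F p ∈ ψ.source) :
    Function.Injective (fderiv ℝ (localRep F φ ψ) (φ p)) := by
  have hFp' : F (φ.symm (φ p)) ∈ ψ.source := by rwa [φ.left_inv hp]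
  have hs : MDifferentiableAt 𝓘(ℝ, RR2) 𝓘(ℝ, RR2) φ.symm (φ p) :=
    (contMDiffAt_symm_of_mem_maximalAtlas hφ (φ.map_source hp)).mdifferentiableAt (by simp)
  have hFd : MDifferentiableAt 𝓘(ℝ, RR2) 𝓘(ℝ, CC2) F (φ.symm (φ p)) :=
    (hF.1 _).mdifferentiableAt (by simp)
  have hψd : MDifferentiableAt 𝓘(ℝ, CC2) 𝓘(ℝ, CC2) ψ (F (φ.symm (φ p))) :=
    (contMDiffAt_of_mem_maximalAtlas hψ hFp').mdifferentiableAt (by simp)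
  rw [← mfderiv_eq_fderiv, localRep, mfderiv_comp (φ p) hψd (hFd.comp (φ p) hs),
    mfderiv_comp (φ p) hFd hs]
  exact (mfderiv_chart_injective hψ hFp').comp
    ((hF.2 _).comp (mfderiv_chart_symm_injective hφ (φ.map_source hp)))

end Manifold

/-! ### Principal symbols of the two operators -/

section Ellipticity

variable {h : CC2 → CC2 →L[ℝ] CC2 →L[ℝ] ℝ} {f : RR2 → CC2} {y : RR2}

/-- The chain rule needs `jetCos` differentiable at the jet, which persists nearby because `jetCos`
is `C¹` where the Gram determinant is positive. -/
lemma eventually_elOp_eq_jetOp (hh : ContDiffAt ℝ 1 h (f y))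
    (hd : 0 < (bilinGram (h (f y)) fun i => pd i f y).det) (β : ℝ) :
    ∀ᶠ x in nhds (jet2 f y), ∀ k, ContDiffAt ℝ 2 k y → jet2 k y = x →
      elOp h k y β = jetOp h β x := by
  have h1 : ∀ᶠ x in nhds (jet1 f y), DifferentiableAt ℝ (jetCos h) x := by
    filter_upwards [(contDiffAt_jetCos (x := jet1 f y) hh hd).eventually (by simp)] with x hx
    exact hx.differentiableAt one_ne_zero
  have h2 : Filter.Tendsto (Prod.fst : Jet2 → Jet1) (nhds (jet2 f y)) (nhds (jet1 f y)) :=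
    continuous_fst.continuousAt
  filter_upwards [h2.eventually h1] with x hx k hk hkx
  subst hkx
  exact elOp_eq_jetOp hk hx β

lemma IsFrame.det_gram_pos {b : CC2 →L[ℝ] CC2 →L[ℝ] ℝ} {p e : Fin 2 → CC2}
    {α : Matrix (Fin 2) (Fin 2) ℝ} (hfr : IsFrame b p e α) : 0 < (bilinGram b p).det := by
  have := hfr.det_sq_mul
  exact pos_of_mul_pos_right (by rw [this]; exact one_pos) (sq_nonneg _)

lemma hasPrincipalSymbolAt_elOp (hh : ContDiffAt ℝ 2 h (f y)) (hb : IsHermitianForm (h (f y)))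
    (hf : ContDiffAt ℝ 2 f y) (hd : 0 < (bilinGram (h (f y)) fun i => pd i f y).det) (β : ℝ) :
    HasPrincipalSymbolAt (fun f y => elOp h f y β) f y fun ξ =>
      (fderiv ℝ (jetOp h β) (jet2 f y)).comp (symbolJet ξ) :=
  hasPrincipalSymbolAt_of_jet hf (differentiableAt_jetOp (x := jet1 f y) hh hb hd β _)
    (eventually_elOp_eq_jetOp (hh.of_le (by norm_num)) hd β)

lemma differentiableAt_jetCos_fst (hh : ContDiffAt ℝ 1 h (f y))
    (hd : 0 < (bilinGram (h (f y)) fun i => pd i f y).det) :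
    DifferentiableAt ℝ (fun z : Jet2 => jetCos h z.1) (jet2 f y) :=
  ((contDiffAt_jetCos (x := jet1 f y) hh hd).differentiableAt one_ne_zero).comp
    (f := Prod.fst) (jet2 f y) differentiableAt_fst

lemma hasPrincipalSymbolAt_normalizedOp (hh : ContDiffAt ℝ 2 h (f y))
    (hb : IsHermitianForm (h (f y))) (hf : ContDiffAt ℝ 2 f y)
    (hd : 0 < (bilinGram (h (f y)) fun i => pd i f y).det) (hc : cosAngle h f y ≠ 0) (β : ℝ) :
    HasPrincipalSymbolAt (fun f y => normalizedOp h f y β) f y fun ξ =>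
      (fderiv ℝ (fun z : Jet2 => (jetCos h z.1)⁻¹ • jetOp h β z) (jet2 f y)).comp
        (symbolJet ξ) := by
  have hC := differentiableAt_jetCos_fst (hh.of_le (by norm_num)) hd
  refine hasPrincipalSymbolAt_of_jet hf ((hC.inv hc).smul
    (differentiableAt_jetOp (x := jet1 f y) hh hb hd β _)) ?_
  filter_upwards [eventually_elOp_eq_jetOp (hh.of_le (by norm_num)) hd β] with x hx k hk hkx
  have := hx k hk hkx
  subst hkx
  rw [normalizedOp, this]
  rfl

/-- Dividing by `cos α` divides the symbol by `cos α`. -/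
lemma fderiv_normalized_symbolJet (hh : ContDiffAt ℝ 2 h (f y)) (hb : IsHermitianForm (h (f y)))
    (hd : 0 < (bilinGram (h (f y)) fun i => pd i f y).det) (hc : cosAngle h f y ≠ 0) (β : ℝ)
    (ξ : RR2 →L[ℝ] ℝ) (G : CC2) :
    fderiv ℝ (fun z : Jet2 => (jetCos h z.1)⁻¹ • jetOp h β z) (jet2 f y) (symbolJet ξ G) =
      (cosAngle h f y)⁻¹ • fderiv ℝ (jetOp h β) (jet2 f y) (symbolJet ξ G) := by
  have hC := differentiableAt_jetCos_fst (hh.of_le (by norm_num)) hd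
  have hΦ := differentiableAt_jetOp (x := jet1 f y) hh hb hd β (fun i j => pd i (pd j f) y)
  -- The factor depends on the first jet only, while `symbolJet` moves only the second derivatives.
  have hinv : fderiv ℝ (fun z : Jet2 => (jetCos h z.1)⁻¹) (jet2 f y) (symbolJet ξ G) = 0 := by
    have hd1 : DifferentiableAt ℝ (fun x : Jet1 => (jetCos h x)⁻¹) (jet1 f y) :=
      ((contDiffAt_jetCos (x := jet1 f y) (hh.of_le (by norm_num)) hd).differentiableAt
        (n := 1) one_ne_zero).inv hc
    have h1 := (HasFDerivAt.comp (f := (Prod.fst : Jet2 → Jet1)) (jet2 f y) hd1.hasFDerivAt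
      hasFDerivAt_fst).fderiv
    change fderiv ℝ ((fun x : Jet1 => (jetCos h x)⁻¹) ∘ Prod.fst) (jet2 f y) _ = 0
    rw [h1]
    simp [symbolJet]
  rw [fderiv_fun_smul (c := fun z : Jet2 => (jetCos h z.1)⁻¹) (hC.inv hc) hΦ]
  simp only [add_apply, smul_apply, ContinuousLinearMap.smulRight_apply]
  rw [hinv, zero_smul, add_zero]
  rfl

/-- A frame of the tangent plane given by vectors of the coordinate plane. -/
lemma isFrame_of_eq_fderiv {a : Fin 2 → RR2} {e : Fin 2 → CC2}
    (ha : ∀ i, e i = fderiv ℝ f y (a i))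
    (he : ∀ i j, h (f y) (e i) (e j) = if i = j then 1 else 0) :
    IsFrame (h (f y)) (fun i => pd i f y) e (Matrix.of fun k i => a k i) :=
  ⟨fun k => by rw [ha, fderiv_eq_sum_pd]; rfl, he⟩

/-- The symbol matrix is positive definite exactly for vectors with a normal component. -/
lemma posDef_symbolMatrix {r s β b₀ b₁ : ℝ} (hβ : 0 ≤ β) (hr : 0 < r) (hs : 0 < s) :
    (!![r * s + β * b₁ ^ 2, -β * b₀ * b₁; -β * b₀ * b₁, r * s + β * b₀ ^ 2]).PosDef := by
  rw [Matrix.posDef_iff_dotProduct_mulVec]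
  refine ⟨?_, fun x hx => ?_⟩
  · ext i j
    fin_cases i <;> fin_cases j <;> simp
  · have hx2 : 0 < x 0 ^ 2 + x 1 ^ 2 := by
      by_contra hneg
      have h0 : x 0 = 0 := by nlinarith [sq_nonneg (x 0), sq_nonneg (x 1)]
      have h1 : x 1 = 0 := by nlinarith [sq_nonneg (x 0), sq_nonneg (x 1)]
      exact hx (by ext i; fin_cases i <;> assumption)
    have h1 : 0 < r * s * (x 0 ^ 2 + x 1 ^ 2) := by positivity
    have h2 : 0 ≤ β * (x 0 * b₁ - x 1 * b₀) ^ 2 := by positivity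
    simp only [dotProduct, Matrix.mulVec, Fin.sum_univ_two, Matrix.of_apply, Matrix.cons_val',
      Matrix.cons_val_zero, Matrix.cons_val_one, Matrix.cons_val_fin_one, Pi.star_apply,
      star_trivial]
    -- The quadratic form of the matrix is the sum of the expressions in `h1` and `h2`.
    nlinarith

end Ellipticity

/-- The linearized geometry at a point of a symplectic surface in local coordinates. -/
structure IsSymplecticJet (h : CC2 → CC2 →L[ℝ] CC2 →L[ℝ] ℝ) (f : RR2 → CC2) (y : RR2) : Prop where
  contDiffAt_metric : ContDiffAt ℝ ∞ h (f y)
  hermitian : IsHermitianForm (h (f y))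
  contDiffAt : ContDiffAt ℝ ∞ f y
  injective : Function.Injective (fderiv ℝ f y)
  cos_pos : 0 < cosAngle h f y

/-- The passage from the manifolds to coordinates: what follows uses only the metric and the surface
in one pair of charts. -/
lemma isSymplecticJet_inCharts {M : Type*} [TopologicalSpace M] [ChartedSpace CC2 M]
    [IsManifold 𝓘(ℂ, CC2) ∞ M] (g : KahlerMetric M)
    {S : Type*} [TopologicalSpace S] [ChartedSpace RR2 S]
    (A : OrientedAtlas S) (F : S → M) (hF : IsSmoothImmersion F) (hsymp : IsSymplectic g A F) :
    InCharts g A F IsSymplecticJet := by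
  intro φ hφ ψ hψ p hp hFp
  have hφ' := A.subset_maximalAtlas hφ
  have hψ' := mem_maximalAtlas_real hψ
  have hu : localRep F φ ψ (φ p) ∈ ψ.target := by
    simp only [localRep, Function.comp, φ.left_inv hp]
    exact ψ.map_source hFp
  exact ⟨(contDiffOn_chart g hψ').contDiffAt (ψ.open_target.mem_nhds hu),
    ⟨chart_symm g ψ _, fun X hX => chart_pos g hψ' hu hX, chart_cxJ g hψ hu⟩,
    contDiffAt_localRep hF.1 hφ' hψ' hp hFp, injective_fderiv_localRep hF hφ' hψ' hp hFp,
    hsymp φ hφ ψ hψ p hp hFp⟩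

/-! ### Symbols and ellipticity at a point of a symplectic surface -/

namespace IsSymplecticJet

variable {h : CC2 → CC2 →L[ℝ] CC2 →L[ℝ] ℝ} {f : RR2 → CC2} {y : RR2}

lemma contDiffAt_metric_two (H : IsSymplecticJet h f y) : ContDiffAt ℝ 2 h (f y) :=
  contDiffAt_infty.1 H.contDiffAt_metric 2

lemma contDiffAt_two (H : IsSymplecticJet h f y) : ContDiffAt ℝ 2 f y :=
  contDiffAt_infty.1 H.contDiffAt 2

lemma exists_isFrame (H : IsSymplecticJet h f y) :
    ∃ e α, IsFrame (h (f y)) (fun i => pd i f y) e α :=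
  BetaSymplectic.exists_isFrame H.hermitian (linearIndependent_pd H.injective)

lemma det_gram_pos (H : IsSymplecticJet h f y) :
    0 < (bilinGram (h (f y)) fun i => pd i f y).det := by
  obtain ⟨e, α, hfr⟩ := H.exists_isFrame
  exact hfr.det_gram_pos

/-- The principal symbol of the Euler-Lagrange operator in an orthonormal frame. -/
lemma fderiv_jetOp (H : IsSymplecticJet h f y) {e : Fin 2 → CC2} {α : Matrix (Fin 2) (Fin 2) ℝ}
    (hfr : IsFrame (h (f y)) (fun i => pd i f y) e α) (β : ℝ) (ξ : RR2 →L[ℝ] ℝ) (G : CC2)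
    {W : CC2} (hW : W = (∑ i, α 0 i * ξ (EuclideanSpace.single i 1)) • cxJ (e 1) -
      (∑ i, α 1 i * ξ (EuclideanSpace.single i 1)) • cxJ (e 0)) :
    fderiv ℝ (jetOp h β) (jet2 f y) (symbolJet ξ G) = cosAngle h f y • ((cosAngle h f y ^ 2 *
      ((∑ i, α 0 i * ξ (EuclideanSpace.single i 1)) ^ 2 +
      (∑ i, α 1 i * ξ (EuclideanSpace.single i 1)) ^ 2)) • normPart h f y G +
        (β * h (f y) (normPart h f y G) W) • normPart h f y W) :=
  (fderiv_jetOp_symbolJet (x := jet1 f y) H.contDiffAt_metric_two H.hermitian hfr β _ ξ G).trans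
    (hfr.elSymbol_eq H.hermitian β _ G hW)

lemma fderiv_normalized (H : IsSymplecticJet h f y) {e : Fin 2 → CC2}
    {α : Matrix (Fin 2) (Fin 2) ℝ} (hfr : IsFrame (h (f y)) (fun i => pd i f y) e α) (β : ℝ)
    (ξ : RR2 →L[ℝ] ℝ) (G : CC2) {W : CC2}
    (hW : W = (∑ i, α 0 i * ξ (EuclideanSpace.single i 1)) • cxJ (e 1) -
      (∑ i, α 1 i * ξ (EuclideanSpace.single i 1)) • cxJ (e 0)) :
    fderiv ℝ (fun z : Jet2 => (jetCos h z.1)⁻¹ • jetOp h β z) (jet2 f y) (symbolJet ξ G) =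
      (cosAngle h f y ^ 2 * ((∑ i, α 0 i * ξ (EuclideanSpace.single i 1)) ^ 2 +
      (∑ i, α 1 i * ξ (EuclideanSpace.single i 1)) ^ 2)) • normPart h f y G +
        (β * h (f y) (normPart h f y G) W) • normPart h f y W := by
  rw [fderiv_normalized_symbolJet H.contDiffAt_metric_two H.hermitian H.det_gram_pos H.cos_pos.ne',
    H.fderiv_jetOp hfr β ξ G hW, inv_smul_smul₀ H.cos_pos.ne']

lemma elliptic_elOp (H : IsSymplecticJet h f y) {β : ℝ} (hβ : 0 ≤ β) :
    ∃ σ, HasPrincipalSymbolAt (fun f y => elOp h f y β) f y σ ∧ IsEllipticModTangent h f y σ := by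
  obtain ⟨e, α, hfr⟩ := H.exists_isFrame
  exact ⟨_, hasPrincipalSymbolAt_elOp H.contDiffAt_metric_two H.hermitian H.contDiffAt_two
    H.det_gram_pos β, hfr.isEllipticModTangent H.hermitian H.cos_pos.ne' hβ H.cos_pos.ne' _
    fun ξ G => H.fderiv_jetOp hfr β ξ G rfl⟩

lemma elliptic_normalizedOp (H : IsSymplecticJet h f y) {β : ℝ} (hβ : 0 ≤ β) :
    IsEllipticModTangent h f y fun ξ =>
      (fderiv ℝ (fun z : Jet2 => (jetCos h z.1)⁻¹ • jetOp h β z) (jet2 f y)).comp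
        (symbolJet ξ) := by
  obtain ⟨e, α, hfr⟩ := H.exists_isFrame
  exact hfr.isEllipticModTangent H.hermitian one_ne_zero hβ H.cos_pos.ne' _
    fun ξ G => (H.fderiv_normalized hfr β ξ G rfl).trans (one_smul ℝ _).symm

/-- The quadratic form of the symbol of the normalized operator. -/
lemma normalized_apply_self (H : IsSymplecticJet h f y) {a : Fin 2 → RR2} {e : Fin 2 → CC2}
    (ha : ∀ i, e i = fderiv ℝ f y (a i))
    (he : ∀ i j, h (f y) (e i) (e j) = if i = j then 1 else 0) (β : ℝ) (ξ : RR2 →L[ℝ] ℝ)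
    (G : CC2) :
    h (f y) (fderiv ℝ (fun z : Jet2 => (jetCos h z.1)⁻¹ • jetOp h β z) (jet2 f y)
        (symbolJet ξ G)) G =
      cosAngle h f y ^ 2 * h (f y) (normPart h f y G) (normPart h f y G) *
          (ξ (a 0) ^ 2 + ξ (a 1) ^ 2) +
        β * (ξ (a 0) * h (f y) (normPart h f y G) (cxJ (e 1)) -
          ξ (a 1) * h (f y) (normPart h f y G) (cxJ (e 0))) ^ 2 := by
  have hfr := isFrame_of_eq_fderiv ha he
  rw [H.fderiv_normalized hfr β ξ G rfl, hfr.symbol_apply_self H.hermitian,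
    apply_eq_sum_single ξ (a 0), apply_eq_sum_single ξ (a 1)]
  simp only [Matrix.of_apply, map_sub, map_smul, smul_eq_mul]
  ring

end IsSymplecticJet

end BetaSymplectic

end

/-! ### The theorem in all charts -/

open BetaSymplectic in
theorem mainTheorem9 {M : Type*} [TopologicalSpace M] [ChartedSpace CC2 M]
    [IsManifold 𝓘(ℂ, CC2) ∞ M] (g : KahlerMetric M)
    {S : Type*} [TopologicalSpace S] [ChartedSpace RR2 S] [IsManifold 𝓘(ℝ, RR2) ∞ S]
    (A : OrientedAtlas S) (F : S → M) (hF : IsSmoothImmersion F) (hsymp : IsSymplectic g A F)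
    (β : ℝ) (hβ : 0 ≤ β) :
    -- the Euler-Lagrange equation is elliptic modulo tangential diffeomorphisms
    (InCharts g A F fun h f y =>
      ∃ σ, HasPrincipalSymbolAt (fun f y => elOp h f y β) f y σ ∧
        IsEllipticModTangent h f y σ) ∧
    -- the symbol of the operator normalized by `cos α`
    (InCharts g A F fun h f y =>
      ∃ σ, HasPrincipalSymbolAt (fun f y => normalizedOp h f y β) f y σ ∧
        IsEllipticModTangent h f y σ ∧
        -- `e₁, e₂` is any orthonormal frame of the tangent plane, the image of `a₁, a₂`
        ∀ (a : Fin 2 → RR2) (e : Fin 2 → CC2), (∀ i, e i = fderiv ℝ f y (a i)) →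
          (∀ i j, h (f y) (e i) (e j) = if i = j then 1 else 0) → ∀ G N : CC2,
          N = normPart h f y G →
          ∃ O : Matrix (Fin 2) (Fin 2) ℝ, O.IsSymm ∧
            (∀ ξ : RR2 →L[ℝ] ℝ, h (f y) (σ ξ G) G = ∑ i, ∑ j, O i j * (ξ (a i) * ξ (a j))) ∧
            O = !![cosAngle h f y ^ 2 * h (f y) N N + β * h (f y) N (cxJ (e 1)) ^ 2,
                    -β * h (f y) N (cxJ (e 0)) * h (f y) N (cxJ (e 1));
                  -β * h (f y) N (cxJ (e 0)) * h (f y) N (cxJ (e 1)),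
                    cosAngle h f y ^ 2 * h (f y) N N + β * h (f y) N (cxJ (e 0)) ^ 2] ∧
            O.det = cosAngle h f y ^ 2 * h (f y) N N * (cosAngle h f y ^ 2 * h (f y) N N
              + β * (h (f y) N (cxJ (e 0)) ^ 2 + h (f y) N (cxJ (e 1)) ^ 2)) ∧
            (O.PosDef ↔ N ≠ 0)) := by
  have H := isSymplecticJet_inCharts g A F hF hsymp
  refine ⟨fun φ hφ ψ hψ p hp hFp => (H φ hφ ψ hψ p hp hFp).elliptic_elOp hβ,
    fun φ hφ ψ hψ p hp hFp => ?_⟩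
  have H := H φ hφ ψ hψ p hp hFp
  refine ⟨_, hasPrincipalSymbolAt_normalizedOp H.contDiffAt_metric_two H.hermitian
    H.contDiffAt_two H.det_gram_pos H.cos_pos.ne' β, H.elliptic_normalizedOp hβ, ?_⟩
  rintro a e ha he G N rfl
  refine ⟨_, ?_, fun ξ => (H.normalized_apply_self ha he β ξ G).trans ?_, rfl, ?_, ?_⟩
  · ext i j
    fin_cases i <;> fin_cases j <;> rfl
  · simp only [Fin.sum_univ_two, Matrix.of_apply, Matrix.cons_val', Matrix.cons_val_zero,
      Matrix.cons_val_one, Matrix.cons_val_fin_one]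
    ring
  · rw [Matrix.det_fin_two_of]
    ring
  · constructor
    · rintro hO h0
      -- For `N = 0` the first diagonal entry vanishes.
      have := hO.diag_pos (i := 0)
      simp [h0] at this
    · exact fun hN => posDef_symbolMatrix hβ (pow_pos H.cos_pos 2) (H.hermitian.pos _ hN)
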